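/- Let $l,m,n,p\ge 1$ be integers, let $|v\rangle$ be a uniformly distributed random unit vector in $\mathbb{C}^l\otimes\mathbb{C}^m\otimes\mathbb{C}^n$, let $V\in\mathcal{M}_{mn,l}(\mathbb{C})$ be the $mn\times l$ matrix with entries $V_{xy,z}=v_{zxy}$ ($x\in[m]$, $y\in[n]$, $z\in[l]$), and let $\rho=VV^*$ be the induced random mixed state on $\mathbb{C}^m\otimes\mathbb{C}^n$. Let $\rho^\Gamma$ denote its partial transpose with the transpose acting only on $\mathbb{C}^n$, i.e. $(\rho^\Gamma)_{xy,x'y'}=\rho_{xy',x'y}$, and put $a:=\frac{mn}{l}$. If $m\ge n$ and $2p^{12}\max\{1,a\}\le n^2$, then $$\mathbb{E}\,\mathrm{Tr}\left[\left(mn\,\rho^\Gamma-I\right)^p\right]\;\le\; 2mn\,p^5\left(2\sqrt a+\frac{\sqrt a\,p}{mn}\right)^p .$$ -/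

import Mathlib

open MeasureTheory Matrix

noncomputable section

/-- The Hilbert space `ℂ^l ⊗ ℂ^m ⊗ ℂ^n`, with the coordinates of a vector in the product basis
indexed by triples `(z, x, y)`. -/
abbrev TripartiteSpace (l m n : ℕ) : Type :=
  EuclideanSpace ℂ (Fin l × Fin m × Fin n)

/-- The unit sphere of `ℂ^l ⊗ ℂ^m ⊗ ℂ^n`. -/
abbrev TripartiteSphere (l m n : ℕ) : Type :=
  Metric.sphere (0 : TripartiteSpace l m n) 1

/-- The uniform probability measure on the unit sphere: the surface measure induced by the
Lebesgue measure of the ambient space (a space of real dimension `2 * l * m * n`), normalised to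
total mass one. -/
def uniformSphere (l m n : ℕ) : Measure (TripartiteSphere l m n) :=
  ((volume : Measure (TripartiteSpace l m n)).toSphere Set.univ)⁻¹ •
    (volume : Measure (TripartiteSpace l m n)).toSphere

/-- The usual identification `|v⟩ ↦ V` of `ℂ^l ⊗ ℂ^m ⊗ ℂ^n` with the `mn × l` matrices. -/
def vecToMatrix {l m n : ℕ} (v : TripartiteSpace l m n) :
    Matrix (Fin m × Fin n) (Fin l) ℂ :=
  Matrix.of fun xy z => v (z, xy.1, xy.2)

/-- The state `ρ = V V*` on `ℂ^m ⊗ ℂ^n` obtained from `|v⟩⟨v|` by tracing out `ℂ^l`. -/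
def reducedState {l m n : ℕ} (v : TripartiteSpace l m n) :
    Matrix (Fin m × Fin n) (Fin m × Fin n) ℂ :=
  vecToMatrix v * (vecToMatrix v)ᴴ

/-- The partial transpose `A^Γ`, the transpose acting only on the second factor `ℂ^n`. -/
def partialTranspose {m n : ℕ} (A : Matrix (Fin m × Fin n) (Fin m × Fin n) ℂ) :
    Matrix (Fin m × Fin n) (Fin m × Fin n) ℂ :=
  Matrix.of fun i j => A (i.1, j.2) (j.1, i.2)

/-- The matrix `mn ρ^Γ - I`. -/
def centeredPT {l m n : ℕ} (v : TripartiteSpace l m n) :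
    Matrix (Fin m × Fin n) (Fin m × Fin n) ℂ :=
  ((m : ℂ) * (n : ℂ)) • partialTranspose (reducedState v) - 1

theorem centeredPT_isHermitian {l m n : ℕ} (v : TripartiteSpace l m n) :
    (centeredPT v).IsHermitian := by
  ext i j
  have h := fun a b => congrFun (congrFun
    (Matrix.isHermitian_mul_conjTranspose_self (vecToMatrix v)).eq a) b
  have h' := h (i.1, j.2) (j.1, i.2)
  simp only [Matrix.conjTranspose_apply] at h'
  simp only [centeredPT, partialTranspose, reducedState, Matrix.conjTranspose_apply,
    Matrix.sub_apply, Matrix.smul_apply, Matrix.of_apply, star_sub, smul_eq_mul, star_mul']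
  rw [h']
  simp [Matrix.one_apply, eq_comm]

/-- `Tr[(mn ρ^Γ - I)^p]` as a real number; the trace is real because the matrix is Hermitian. -/
def traceMoment {l m n : ℕ} (p : ℕ) (v : TripartiteSpace l m n) : ℝ :=
  (((centeredPT v) ^ p).trace).re

theorem ofReal_traceMoment {l m n : ℕ} (p : ℕ) (v : TripartiteSpace l m n) :
    ((traceMoment p v : ℝ) : ℂ) = ((centeredPT v) ^ p).trace := by
  have h : ((centeredPT v) ^ p).IsHermitian := (centeredPT_isHermitian v).pow p
  apply Complex.conj_eq_iff_re.mp
  rw [starRingEnd_apply, ← Matrix.trace_conjTranspose, h.eq]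

end

set_option linter.unusedSectionVars false

/-! The proof compares the sphere with a Gaussian vector. A standard complex Gaussian vector of
radius `r` in a fixed direction gives the matrix `t • P - 1`, where `P` is the partially transposed
state of that direction and `t = r ^ 2 / l` has mean `m * n`. For even `q` the trace of its `q`-th
power is convex in `t`, so the spherical moment is at most the Gaussian one
(`integral_traceMoment_toSphere_le`).

Wick's formula turns the Gaussian moment into a sum over permutations, and subtracting the identity
removes exactly those with a fixed point. With `c` the rotation of `q` points and # the number of
cycles, a derangement `π` contributes l^#π · m^#(cπ⁻¹) · n^#(cπ) / l^q
(`integral_trace_centered_ptGram_pow`).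

The defect `D` of `π` is the gap in 2#π + #(cπ) + #(cπ⁻¹) ≤ 2q + 2. Genus and Euler inequalities
show that each unit of defect costs a factor √(max 1 a) / n in weight (`permWeight_le`). It gains at
most `q ^ 4` in number (`card_derangementsOfDefect_le`): `D` transpositions turn `π` into an
involution with genus defect at most `D / 2` and at most `D` fixed points; handles are removed at a
cost of `q ^ 3` each; and genus-zero involutions are noncrossing, hence encoded by their openers and
fixed points. The hypothesis makes the ratio `q ^ 4 * √(max 1 a) / n` at most 1/2, so the sum over
`D` is geometric and even moments are at most 4mn(2√a)^q.

Odd moments with `p ≥ 3` are interpolated between the two neighbouring even ones; for `p = 1` the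
trace vanishes. The stated bound has room to spare, since 4 ≤ 2p⁵ once `p ≥ 2`. -/

noncomputable section

/-! ### Cycle counts as dimensions of spaces of invariant functions -/

section OrbitCount

open Equiv

variable {α : Type*} [Fintype α] [DecidableEq α]

/-- The rational functions that are invariant under a permutation. -/
def invariantFunctions (σ : Perm α) : Submodule ℚ (α → ℚ) where
  carrier := {u | ∀ i, u (σ i) = u i}
  add_mem' := by
    intro u w hu hw i
    simp [hu i, hw i]
  zero_mem' := by intro i; rfl
  smul_mem' := by
    intro r u hu i
    simp [hu i]

/-- The number of orbits (cycles, fixed points included) of a permutation. -/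
def orbitCount (σ : Perm α) : ℕ := Module.finrank ℚ (invariantFunctions σ)

theorem mem_invariantFunctions {σ : Perm α} {u : α → ℚ} :
    u ∈ invariantFunctions σ ↔ ∀ i, u (σ i) = u i := Iff.rfl

theorem apply_eq_of_sameCycle {β : Type*} {σ : Perm α} {u : α → β} (hu : ∀ i, u (σ i) = u i)
    {x y : α} (h : σ.SameCycle x y) : u x = u y := by
  obtain ⟨k, rfl⟩ := h
  have hn : ∀ n : ℕ, ∀ z, u ((σ ^ n) z) = u z := by
    intro n
    induction n with
    | zero => simp
    | succ n ih => intro z; rw [pow_succ', Perm.mul_apply, hu, ih]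
  rcases k with n | n
  · simpa using (hn n x).symm
  · have := hn (n + 1) ((σ ^ (Int.negSucc n)) x)
    rw [← this, zpow_negSucc]
    simp

/-- Invariant functions are the functions on the set of cycles. -/
def invariantEquiv (σ : Perm α) (β : Type*) :
    {u : α → β // ∀ i, u (σ i) = u i} ≃ (Quotient (Perm.SameCycle.setoid σ) → β) where
  toFun u := fun q => Quotient.lift u.1 (fun _ _ h => apply_eq_of_sameCycle u.2 h) q
  invFun w := ⟨fun i => w (Quotient.mk _ i), fun i => congrArg w
    (Quotient.sound (show σ.SameCycle (σ i) i from by simp [Perm.SameCycle.refl]))⟩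
  left_inv u := rfl
  right_inv w := by
    funext q
    induction q using Quotient.ind
    rfl

theorem orbitCount_eq_card (σ : Perm α) :
    orbitCount σ = Nat.card (Quotient (Perm.SameCycle.setoid σ)) := by
  classical
  let e : invariantFunctions σ ≃ₗ[ℚ] (Quotient (Perm.SameCycle.setoid σ) → ℚ) :=
    { invariantEquiv σ ℚ with
      map_add' := by
        intro u w; funext q
        induction q using Quotient.ind
        rfl
      map_smul' := by
        intro r u; funext q
        induction q using Quotient.ind
        rfl }
  rw [orbitCount, e.finrank_eq, Module.finrank_pi, Nat.card_eq_fintype_card]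

theorem card_invariant (σ : Perm α) (β : Type*) [Fintype β] :
    Nat.card {u : α → β // ∀ i, u (σ i) = u i} = Fintype.card β ^ orbitCount σ := by
  classical
  rw [Nat.card_congr (invariantEquiv σ β), orbitCount_eq_card, Nat.card_fun,
    Nat.card_eq_fintype_card (α := β)]

theorem sameCycle_of_forall_invariant {σ : Perm α} {x y : α}
    (h : ∀ u ∈ invariantFunctions σ, u x = u y) : σ.SameCycle x y := by
  classical
  have := h (fun i => if σ.SameCycle x i then 1 else 0) (by intro i; simp)
  by_contra hxy
  simp [hxy, Perm.SameCycle.refl] at this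

theorem orbitCount_lt_of_lt {σ τ : Perm α}
    (h : ∀ u ∈ invariantFunctions σ, u ∈ invariantFunctions τ) (u : α → ℚ)
    (hu : u ∈ invariantFunctions τ) (hu' : u ∉ invariantFunctions σ) :
    orbitCount σ < orbitCount τ :=
  Submodule.finrank_lt_finrank_of_lt (lt_of_le_of_ne h (fun e => hu' (e ▸ hu)))

theorem invariantFunctions_inv (σ : Perm α) : invariantFunctions σ⁻¹ = invariantFunctions σ := by
  ext u
  constructor
  · intro h i
    simpa using (h (σ i)).symm
  · intro h i
    simpa using (h (σ⁻¹ i)).symm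

theorem orbitCount_inv (σ : Perm α) : orbitCount σ⁻¹ = orbitCount σ := by
  rw [orbitCount, invariantFunctions_inv, orbitCount]

theorem finrank_le_of_linearMap {V W : Type*} [AddCommGroup V] [Module ℚ V] [AddCommGroup W]
    [Module ℚ W] {p : Submodule ℚ V} {q : Submodule ℚ W} [Module.Finite ℚ q] (f : V →ₗ[ℚ] W)
    (hf : ∀ u ∈ p, f u ∈ q) (hinj : ∀ u ∈ p, f u = 0 → u = 0) :
    Module.finrank ℚ p ≤ Module.finrank ℚ q := by
  refine LinearMap.finrank_le_finrank_of_injective (f := f.restrict hf) ?_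
  rw [← LinearMap.ker_eq_bot, LinearMap.ker_eq_bot']
  intro u hu
  exact Subtype.ext (hinj u.1 u.2 (congrArg Subtype.val hu))

theorem orbitCount_conj (θ σ : Perm α) : orbitCount (θ * σ * θ⁻¹) = orbitCount σ := by
  have key : ∀ θ σ : Perm α, orbitCount (θ * σ * θ⁻¹) ≤ orbitCount σ := by
    intro θ σ
    refine finrank_le_of_linearMap (LinearMap.funLeft ℚ ℚ θ) ?_ ?_
    · intro u hu i
      simpa [LinearMap.funLeft_apply] using hu (θ i)
    · intro u _ h
      ext i
      simpa [LinearMap.funLeft_apply] using congrFun h (θ⁻¹ i)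
  refine le_antisymm (key θ σ) ?_
  have := key θ⁻¹ (θ * σ * θ⁻¹)
  simpa [mul_assoc] using this

theorem orbitCount_mul_comm (σ τ : Perm α) : orbitCount (σ * τ) = orbitCount (τ * σ) := by
  have := orbitCount_conj τ (σ * τ)
  rw [← this]
  simp [mul_assoc]

theorem finrank_invariantFunctions_le_one {c : Perm α} (hc : ∀ x y, c.SameCycle x y) :
    orbitCount c ≤ 1 := by
  rw [orbitCount_eq_card, Finite.card_le_one_iff_subsingleton]
  refine ⟨?_⟩
  intro a b
  induction a using Quotient.ind
  induction b using Quotient.ind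
  exact Quotient.sound (hc _ _)

/-- The genus inequality for a pair of permutations whose product is a full cycle. -/
theorem orbitCount_add_le {c : Perm α} (hc : ∀ x y, c.SameCycle x y) (π : Perm α) :
    orbitCount π + orbitCount (c * π) ≤ Fintype.card α + 1 := by
  have h1 := Submodule.finrank_sup_add_finrank_inf_eq (invariantFunctions π)
    (invariantFunctions (c * π))
  have h2 : Module.finrank ℚ ↥(invariantFunctions π ⊔ invariantFunctions (c * π)) ≤
      Fintype.card α := by
    refine (Submodule.finrank_le _).trans ?_
    simp
  -- A function invariant under both `π` and `c * π` is invariant under `c`, hence constant.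
  have h3 : Module.finrank ℚ ↥(invariantFunctions π ⊓ invariantFunctions (c * π)) ≤ 1 := by
    refine le_trans (Submodule.finrank_mono ?_) (finrank_invariantFunctions_le_one hc)
    rintro u ⟨hu1, hu2⟩ i
    have h4 := hu2 (π⁻¹ i)
    have h5 := hu1 (π⁻¹ i)
    simp at h4 h5
    rw [h4, h5]
  unfold orbitCount
  omega

/-- A function invariant under `c * c` is determined by its values at `x` and `c x`. -/
theorem orbitCount_sq_le_two {c : Perm α} (hc : ∀ x y, c.SameCycle x y) :
    orbitCount (c * c) ≤ 2 := by
  classical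
  rcases isEmpty_or_nonempty α with hα | ⟨⟨x⟩⟩
  · rw [orbitCount]
    have : Subsingleton (invariantFunctions (c * c)) := inferInstance
    simp [Module.finrank_zero_of_subsingleton]
  · let f : invariantFunctions (c * c) →ₗ[ℚ] (Fin 2 → ℚ) :=
      { toFun := fun u => ![u.1 x, u.1 (c x)]
        map_add' := by intro u w; ext i; fin_cases i <;> rfl
        map_smul' := by intro r u; ext i; fin_cases i <;> rfl }
    have hf : Function.Injective f := by
      rw [← LinearMap.ker_eq_bot, LinearMap.ker_eq_bot']
      intro u hu
      have h0 : u.1 x = 0 := congrFun hu 0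
      have h1 : u.1 (c x) = 0 := congrFun hu 1
      have key : ∀ n : ℕ, u.1 ((c ^ n) x) = 0 ∧ u.1 ((c ^ (n + 1)) x) = 0 := by
        intro n
        induction n with
        | zero => simpa using ⟨h0, h1⟩
        | succ n ih =>
          refine ⟨ih.2, ?_⟩
          rw [← ih.1, ← u.2 ((c ^ n) x), pow_succ', pow_succ']
          rfl
      ext y
      obtain ⟨n, -, hn⟩ := (hc x y).exists_pow_eq'
      have := (key n).1
      rw [hn] at this
      simpa using this
    have := LinearMap.finrank_le_finrank_of_injective hf
    simpa [orbitCount] using this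

/-- Euler's inequality for the (possibly non-orientable) surface built from `c` and `π`. -/
theorem orbitCount_mul_add_orbitCount_mul_inv_le {c : Perm α} (hc : ∀ x y, c.SameCycle x y)
    (π : Perm α) :
    orbitCount (c * π) + orbitCount (c * π⁻¹) ≤ Fintype.card α + 2 := by
  -- The map sends `(u, w)` to `u - w ∘ π`. On its kernel `u = w ∘ π`, and the two invariances
  -- combine to make `u` invariant under `c * c`, so the kernel has dimension at most two.
  let f : (invariantFunctions (c * π) × invariantFunctions (c * π⁻¹)) →ₗ[ℚ] (α → ℚ) :=
    (invariantFunctions (c * π)).subtype.coprod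
      (-(LinearMap.funLeft ℚ ℚ π) ∘ₗ (invariantFunctions (c * π⁻¹)).subtype)
  have hf : ∀ u i, f u i = u.1.1 i - u.2.1 (π i) := by
    intro u i
    simp [f, LinearMap.funLeft_apply, sub_eq_add_neg]
  have h1 := LinearMap.finrank_range_add_finrank_ker f
  have h2 : Module.finrank ℚ (LinearMap.range f) ≤ Fintype.card α := by
    refine (Submodule.finrank_le _).trans ?_
    simp
  have h3 : Module.finrank ℚ (LinearMap.ker f) ≤ orbitCount (c * c) := by
    have hmem : ∀ u ∈ LinearMap.ker f, ∀ i, u.2.1 (π i) = u.1.1 i := by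
      intro u hu i
      have := congrFun (LinearMap.mem_ker.mp hu) i
      rw [hf] at this
      exact (sub_eq_zero.mp this).symm
    refine finrank_le_of_linearMap
      ((invariantFunctions (c * π)).subtype ∘ₗ LinearMap.fst ℚ _ _) ?_ ?_
    · rintro ⟨u, w⟩ h i
      have hm := hmem _ h
      have hu := u.2
      have hw := w.2
      rw [mem_invariantFunctions] at hu hw
      simp only [Perm.mul_apply] at hu hw hm ⊢
      show u.1 (c (c i)) = u.1 i
      have e1 := hu (π⁻¹ (c i))
      have e2 := hw (π i)
      have e3 := hm (π⁻¹ (c i))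
      simp at e1 e2 e3
      rw [e1, ← e3, e2, hm]
    · rintro ⟨u, w⟩ hk h
      have hu : u = 0 := Subtype.ext h
      subst hu
      have : w = 0 := by
        ext i
        have a1 := hmem _ hk (π⁻¹ i)
        simpa using a1
      subst this
      rfl
  have h4 := orbitCount_sq_le_two hc
  rw [Module.finrank_prod] at h1
  unfold orbitCount at *
  omega

/-- The single linear condition `u x = u y` makes a `σ`-invariant function invariant under `swap x y
* σ`. -/
theorem orbitCount_le_orbitCount_swap_mul (σ : Perm α) (x y : α) :
    orbitCount σ ≤ orbitCount (swap x y * σ) + 1 := by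
  let g : invariantFunctions σ →ₗ[ℚ] ℚ :=
    (LinearMap.proj x - LinearMap.proj (R := ℚ) (φ := fun _ : α => ℚ) y) ∘ₗ
      (invariantFunctions σ).subtype
  have h1 := LinearMap.finrank_range_add_finrank_ker g
  have h2 : Module.finrank ℚ (LinearMap.range g) ≤ 1 := by
    refine (Submodule.finrank_le _).trans ?_
    simp
  have h3 : Module.finrank ℚ (LinearMap.ker g) ≤ orbitCount (swap x y * σ) := by
    refine finrank_le_of_linearMap (invariantFunctions σ).subtype ?_ ?_
    · intro u hu i
      have hxy : u.1 x = u.1 y := by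
        have : u.1 x - u.1 y = 0 := LinearMap.mem_ker.mp hu
        exact sub_eq_zero.mp this
      have hs : ∀ j, u.1 (swap x y j) = u.1 j := by
        intro j
        rw [swap_apply_def]
        split_ifs with h h'
        · rw [h, hxy]
        · rw [h', hxy]
        · rfl
      show u.1 (swap x y (σ i)) = u.1 i
      rw [hs, u.2]
    · intro u _ h
      exact Subtype.ext h
  unfold orbitCount at *
  omega

theorem orbitCount_le_orbitCount_mul_swap (σ : Perm α) (x y : α) :
    orbitCount σ ≤ orbitCount (σ * swap x y) + 1 := by
  rw [orbitCount_mul_comm]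
  exact orbitCount_le_orbitCount_swap_mul σ x y

/-- Multiplying by a transposition of two points of the same cycle splits that cycle. -/
theorem orbitCount_lt_orbitCount_swap_mul {σ : Perm α} {x y : α} (hxy : x ≠ y)
    (h : σ.SameCycle x y) : orbitCount σ < orbitCount (swap x y * σ) := by
  classical
  have hex : ∃ k : ℕ, (σ ^ k) x = y := by
    obtain ⟨n, -, hn⟩ := h.exists_pow_eq'
    exact ⟨n, hn⟩
  let k := Nat.find hex
  have hk : (σ ^ k) x = y := Nat.find_spec hex
  have hmin : ∀ i < k, (σ ^ i) x ≠ y := fun i hi => Nat.find_min hex hi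
  have hk0 : 0 < k := by
    rcases Nat.eq_zero_or_pos k with h0 | h0
    · rw [h0] at hk
      exact absurd hk hxy
    · exact h0
  have hne : ∀ i, 0 < i → i < k → (σ ^ i) x ≠ x := by
    intro i hi0 hik hx
    apply hmin (k - i) (by omega)
    have : (σ ^ (k - i)) ((σ ^ i) x) = y := by
      rw [← Perm.mul_apply, ← pow_add, Nat.sub_add_cancel hik.le, hk]
    rwa [hx] at this
  -- The arc from `x` up to just before `y` becomes a union of cycles of `swap x y * σ`; its
  -- indicator is the new invariant function.
  let S : Set α := {z | ∃ i < k, (σ ^ i) x = z}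
  have hS : ∀ z, swap x y (σ z) ∈ S ↔ z ∈ S := by
    have fwd : ∀ z ∈ S, swap x y (σ z) ∈ S := by
      rintro z ⟨i, hi, rfl⟩
      rw [← Perm.mul_apply σ, ← pow_succ']
      rcases Nat.lt_or_ge (i + 1) k with h1 | h1
      · rw [swap_apply_of_ne_of_ne (hne _ (by omega) h1) (hmin _ h1)]
        exact ⟨i + 1, h1, rfl⟩
      · have : i + 1 = k := by omega
        rw [this, hk, swap_apply_right]
        exact ⟨0, hk0, rfl⟩
    intro z
    constructor
    · intro hz
      have hmaps : Set.MapsTo (swap x y * σ) S S := fun z hz => fwd z hz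
      obtain ⟨w, hw, hwz⟩ := Set.surj_on_of_inj_on_of_ncard_le (fun a (_ : a ∈ S) =>
        (swap x y * σ) a) (fun a ha => hmaps ha)
        (fun a b _ _ e => (swap x y * σ).injective e) le_rfl (Set.toFinite _) _ hz
      have : w = z := (swap x y * σ).injective hwz.symm
      exact this ▸ hw
    · exact fwd z
  refine orbitCount_lt_of_lt ?_ (S.indicator 1) ?_ ?_
  · intro u hu i
    have huxy : u x = u y := apply_eq_of_sameCycle hu h
    rw [Perm.mul_apply, swap_apply_def]
    split_ifs with h1 h2
    · rw [← huxy, ← h1, hu]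
    · rw [huxy, ← h2, hu]
    · exact hu i
  · intro z
    by_cases hz : z ∈ S
    · simp [hz, hS z]
    · simp [hz, hS z]
  · intro hmem
    have e := apply_eq_of_sameCycle hmem h
    have hx : x ∈ S := ⟨0, hk0, rfl⟩
    have hy : y ∉ S := fun ⟨i, hi, h⟩ => hmin i hi h
    simp [hx, hy] at e

end OrbitCount

/-! ### Reducing permutations to involutions by splitting cycles -/

section Involution

open Equiv

variable {α : Type*} [Fintype α] [DecidableEq α]

/-- The number of fixed points. -/
def fixedCount (σ : Perm α) : ℕ := (Finset.univ.filter fun i => σ i = i).card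

theorem sameCycle_of_involutive {π : Perm α} (h : ∀ x, π (π x) = x) {x y : α}
    (hxy : π.SameCycle x y) : x = y ∨ π x = y := by
  have := apply_eq_of_sameCycle (u := fun z => (s(z, π z) : Sym2 α)) (σ := π)
    (fun z => by simp [h z, Sym2.eq_swap]) hxy
  rw [Sym2.eq_iff] at this
  rcases this with h | h
  · exact Or.inl h.1
  · exact Or.inr h.2

theorem orbitCount_involution_eq [LinearOrder α] {π : Perm α} (h : ∀ x, π (π x) = x) :
    orbitCount π = (Finset.univ.filter fun i => i ≤ π i).card := by
  rw [orbitCount_eq_card, ← Fintype.card_subtype, ← Nat.card_eq_fintype_card]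
  symm
  refine Nat.card_congr (Equiv.ofBijective (fun i => Quotient.mk _ i.1) ⟨?_, ?_⟩)
  · rintro ⟨i, hi⟩ ⟨j, hj⟩ hij
    have : π.SameCycle i j := Quotient.exact hij
    rcases sameCycle_of_involutive h this with e | e
    · exact Subtype.ext e
    · refine Subtype.ext (le_antisymm (e ▸ hi) ?_)
      subst e
      simpa [h] using hj
  · intro q
    induction q using Quotient.ind with
    | _ i =>
    rcases le_total i (π i) with hi | hi
    · exact ⟨⟨i, hi⟩, rfl⟩
    · exact ⟨⟨π i, by rwa [h]⟩, Quotient.sound (show π.SameCycle (π i) i from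
        by simp [Perm.SameCycle.refl])⟩

theorem card_apply_lt_involution [LinearOrder α] {π : Perm α} (h : ∀ x, π (π x) = x) :
    (Finset.univ.filter fun i => π i < i).card + orbitCount π = Fintype.card α := by
  rw [orbitCount_involution_eq h, add_comm]
  have := Finset.card_filter_add_card_filter_not (s := (Finset.univ : Finset α))
    (fun i => i ≤ π i)
  simpa using this

theorem two_mul_orbitCount_involution {π : Perm α} (h : ∀ x, π (π x) = x) :
    2 * orbitCount π = Fintype.card α + fixedCount π := by
  classical
  obtain ⟨l⟩ : Nonempty (LinearOrder α) := ⟨linearOrderOfSTO WellOrderingRel⟩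
  have h1 := card_apply_lt_involution h
  have h2 := orbitCount_involution_eq h
  have h3 : (Finset.univ.filter fun i => π i < i).card =
      (Finset.univ.filter fun i => i < π i).card := by
    refine Finset.card_bij (fun i _ => π i) ?_ ?_ ?_
    · intro i hi
      simpa [h] using hi
    · intro i _ j _ hij
      exact π.injective hij
    · intro i hi
      exact ⟨π i, by simpa [h] using hi, h i⟩
  have h4 : (Finset.univ.filter fun i => i ≤ π i).card =
      (Finset.univ.filter fun i => i < π i).card + fixedCount π := by
    rw [fixedCount, ← Finset.card_union_of_disjoint]
    · congr 1
      ext i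
      simp [le_iff_lt_or_eq, eq_comm]
    · rw [Finset.disjoint_filter]
      intro i _ h1 h2
      exact h1.ne' h2
  omega

/-- Splitting a two-cycle off a cycle of length at least three. -/
theorem exists_swap_of_not_involutive {π : Perm α} (h : ¬ ∀ x, π (π x) = x) :
    ∃ x z : α, orbitCount π + 1 ≤ orbitCount (swap x z * π) ∧
      fixedCount (swap x z * π) ≤ fixedCount π + 1 := by
  push Not at h
  obtain ⟨x, hx⟩ := h
  refine ⟨x, π (π x), orbitCount_lt_orbitCount_swap_mul hx.symm (by simp [Perm.SameCycle.refl]), ?_⟩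
  unfold fixedCount
  have hsub : (Finset.univ.filter fun i => (swap x (π (π x)) * π) i = i) ⊆
      insert (π⁻¹ x) (Finset.univ.filter fun i => π i = i) := by
    intro i hi
    replace hi := (Finset.mem_filter.mp hi).2
    rw [Perm.mul_apply] at hi
    simp only [Finset.mem_insert, Finset.mem_filter, Finset.mem_univ, true_and]
    rw [swap_apply_def] at hi
    split_ifs at hi with h1 h2
    · left
      rw [← h1]; simp
    · exfalso
      have : i = π x := π.injective h2
      rw [← hi] at this
      rw [← this] at hx
      exact hx this.symm
    · exact Or.inr hi
  exact (Finset.card_le_card hsub).trans (Finset.card_insert_le _ _)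

/-- Splitting off cycles reduces to an involution, where equality holds; each split raises the left
side by at least 2 and the right side by at most 1. -/
theorem two_mul_orbitCount_le (π : Perm α) :
    2 * orbitCount π ≤ Fintype.card α + fixedCount π := by
  have hle : ∀ σ : Perm α, orbitCount σ ≤ Fintype.card α := by
    intro σ
    refine (Submodule.finrank_le _).trans ?_
    simp
  induction hn : Fintype.card α - orbitCount π using Nat.strong_induction_on generalizing π with
  | _ n ih =>
  by_cases h : ∀ x, π (π x) = x
  · exact (two_mul_orbitCount_involution h).le
  · obtain ⟨x, z, h1, h2⟩ := exists_swap_of_not_involutive h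
    have := hle π
    have := hle (swap x z * π)
    have := ih _ (by omega) (swap x z * π) rfl
    omega

/-- A permutation becomes an involution after at most `V` multiplications by transpositions. -/
theorem exists_involution_of_le [Nonempty α] {c : Perm α} (V : ℕ) (π : Perm α)
    (h : Fintype.card α + fixedCount π ≤ 2 * orbitCount π + V) :
    ∃ (t : Fin V → α × α) (π' : Perm α), (∀ x, π' (π' x) = x) ∧
      fixedCount π' ≤ fixedCount π + V ∧
      π = (List.ofFn fun i => swap (t i).1 (t i).2).prod * π' ∧
      2 * orbitCount π + orbitCount (c * π) + orbitCount (c * π⁻¹) ≤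
        2 * orbitCount π' + orbitCount (c * π') + orbitCount (c * π'⁻¹) := by
  induction V generalizing π with
  | zero =>
    refine ⟨Fin.elim0, π, ?_, by simp, by simp, le_rfl⟩
    by_contra hn
    obtain ⟨x, z, h1, h2⟩ := exists_swap_of_not_involutive hn
    have := two_mul_orbitCount_le (swap x z * π)
    omega
  | succ V ih =>
    by_cases hn : ∀ x, π (π x) = x
    · obtain ⟨x⟩ := ‹Nonempty α›
      -- Unused transpositions are filled with the trivial `swap x x`.
      refine ⟨fun _ => (x, x), π, hn, by omega, ?_, le_rfl⟩
      simp [List.prod_replicate, ← Perm.one_def]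
    · obtain ⟨x, z, h1, h2⟩ := exists_swap_of_not_involutive hn
      obtain ⟨t, π', hinv, hfix, hprod, hD⟩ := ih (swap x z * π) (by omega)
      refine ⟨Fin.cons (x, z) t, π', hinv, by omega, ?_, ?_⟩
      · rw [List.ofFn_succ, List.prod_cons]
        simp only [Fin.cons_zero, Fin.cons_succ]
        rw [mul_assoc, ← hprod, ← mul_assoc, Equiv.swap_mul_self, one_mul]
      -- The split gains at least 2 in `2 * orbitCount π`, while each of the other two counts loses
      -- at most 1.
      · have e1 : c * (swap x z * π) = swap (c x) (c z) * (c * π) := by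
          rw [← mul_assoc, mul_swap_eq_swap_mul, mul_assoc]
        have e2 : c * (swap x z * π)⁻¹ = (c * π⁻¹) * swap x z := by
          rw [_root_.mul_inv_rev, swap_inv, mul_assoc]
        have h3 := orbitCount_le_orbitCount_swap_mul (c * π) (c x) (c z)
        have h4 := orbitCount_le_orbitCount_mul_swap (c * π⁻¹) x z
        rw [← e1] at h3
        rw [← e2] at h4
        omega

end Involution

/-! ### Removing a handle by multiplying the full cycle by a 3-cycle -/

section Gluing

open Equiv

/-- Put `σ = finRotate (k + 1) * π`. Every `i` with `π i < i`, and also `π (Fin.last k)`, satisfies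
`σ i ≤ i`, so positive defect gives more weak descents than cycles of `σ`. Two of them share a
cycle, and at least one does not map to the minimum `m` of that cycle: this is `e`. -/
theorem exists_splitting_triple {k : ℕ} {π : Perm (Fin (k + 1))} (h : ∀ x, π (π x) = x)
    (hd : orbitCount π + orbitCount (finRotate (k + 1) * π) < k + 2) :
    ∃ m b e, m < b ∧ b < e ∧ (finRotate (k + 1) * π) e = b ∧
      (finRotate (k + 1) * π).SameCycle m e := by
  classical
  set σ := finRotate (k + 1) * π with hσ
  let S : Finset (Fin (k + 1)) := Finset.univ.filter fun i => σ i ≤ i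
  have hS : k + 2 ≤ S.card + orbitCount π := by
    have h1 := card_apply_lt_involution h
    rw [Fintype.card_fin] at h1
    have hsub : insert (π (Fin.last k)) (Finset.univ.filter fun i => π i < i) ⊆ S := by
      intro i hi
      rw [Finset.mem_insert, Finset.mem_filter] at hi
      refine Finset.mem_filter.mpr ⟨Finset.mem_univ _, ?_⟩
      rw [hσ, Perm.mul_apply]
      rcases hi with rfl | ⟨-, hi⟩
      · rw [h, finRotate_last]
        exact Fin.zero_le _
      · have hlt : π i ≠ Fin.last k := (hi.trans_le (Fin.le_last i)).ne
        rw [Fin.le_def, coe_finRotate_of_ne_last hlt]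
        exact hi
    have h2 := Finset.card_le_card hsub
    rw [Finset.card_insert_of_notMem] at h2
    · omega
    · simp only [Finset.mem_filter, Finset.mem_univ, true_and, h, not_lt]
      exact Fin.le_last _
  obtain ⟨i, hi, j, hj, hij, hq⟩ := Finset.exists_ne_map_eq_of_card_lt_of_maps_to
    (s := S) (t := (Finset.univ : Finset (Quotient (Perm.SameCycle.setoid σ))))
    (f := fun i => Quotient.mk _ i) (by
      rw [Finset.card_univ, ← Nat.card_eq_fintype_card, ← orbitCount_eq_card]; omega)
    (fun _ _ => Finset.mem_coe.mpr (Finset.mem_univ _))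
  have hcyc : σ.SameCycle i j := Quotient.exact hq
  let C : Finset (Fin (k + 1)) := Finset.univ.filter fun x => σ.SameCycle i x
  have hiC : i ∈ C := by simp [C, Perm.SameCycle.refl]
  let m := C.min' ⟨i, hiC⟩
  have hm : σ.SameCycle i m := by
    have := C.min'_mem ⟨i, hiC⟩
    exact (Finset.mem_filter.mp this).2
  have hmin : ∀ x, σ.SameCycle i x → m ≤ x := fun x hx =>
    C.min'_le x (by simpa [C] using hx)
  have key : ∀ e f, e ≠ f → σ.SameCycle i e → σ.SameCycle i f → σ e ≤ e → σ e ≠ m →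
      ∃ m b e, m < b ∧ b < e ∧ σ e = b ∧ σ.SameCycle m e := by
    intro e f hef he hf hle hne
    refine ⟨m, σ e, e, lt_of_le_of_ne (hmin _ (by simpa using he)) hne.symm,
      lt_of_le_of_ne hle ?_, rfl, hm.symm.trans he⟩
    intro hfix
    have : σ.SameCycle e f := he.symm.trans hf
    obtain ⟨n, hn⟩ := this
    rw [Perm.zpow_apply_eq_self_of_apply_eq_self hfix] at hn
    exact hef hn
  have hi' := (Finset.mem_filter.mp hi).2
  have hj' := (Finset.mem_filter.mp hj).2
  by_cases him : σ i = m
  · refine key j i hij.symm hcyc (Perm.SameCycle.refl _ _) hj' ?_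
    rw [← him]
    exact fun h => hij (σ.injective h).symm
  · exact key i j hij (Perm.SameCycle.refl _ _) hcyc hi' him

/-- The first swap turns `e` into a fixed point and leaves `m` and `b` together in the rest of the
cycle, so the second swap splits again. -/
theorem orbitCount_split_triple {α : Type*} [Fintype α] [DecidableEq α] {σ : Perm α} {m b e : α}
    (hmb : m ≠ b) (hbe : b ≠ e) (hme : m ≠ e) (hσ : σ e = b) (hc : σ.SameCycle m e) :
    orbitCount σ + 2 ≤ orbitCount (swap m b * (swap e b * σ)) := by
  have h1 : orbitCount σ < orbitCount (swap e b * σ) :=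
    orbitCount_lt_orbitCount_swap_mul hbe.symm (by rw [← hσ]; simp [Perm.SameCycle.refl])
  have h2 : (swap e b * σ).SameCycle m b := by
    refine sameCycle_of_forall_invariant fun u hu => ?_
    rw [mem_invariantFunctions] at hu
    have hu' : ∀ i, Function.update u e (u b) (σ i) = Function.update u e (u b) i := by
      intro i
      have hi := hu i
      rw [Perm.mul_apply] at hi
      by_cases hie : i = e
      · subst hie
        rw [hσ, Function.update_of_ne hbe, Function.update_self]
      · rw [Function.update_of_ne hie]
        by_cases hse : σ i = e
        · rw [hse, swap_apply_left] at hi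
          rw [hse, Function.update_self, hi]
        · have hsb : σ i ≠ b := fun h => hie (σ.injective (h.trans hσ.symm))
          rw [swap_apply_of_ne_of_ne hse hsb] at hi
          rw [Function.update_of_ne hse, hi]
    have := apply_eq_of_sameCycle hu' hc
    rwa [Function.update_of_ne hme, Function.update_self] at this
  have h3 := orbitCount_lt_orbitCount_swap_mul hmb h2
  omega

theorem eq_of_forall_succ {β : Type*} {U : ℕ → β} {s t : ℕ}
    (h : ∀ i, s ≤ i → i + 1 < t → U (i + 1) = U i) :
    ∀ i, s ≤ i → i < t → U i = U s := by
  intro i hi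
  induction i, hi using Nat.le_induction with
  | base => intro _; rfl
  | succ i hi ih => intro hit; rw [h i hi hit, ih (by omega)]

theorem finRotate_apply_mk {k i : ℕ} (h : i + 1 < k + 1) :
    finRotate (k + 1) ⟨i, by omega⟩ = ⟨i + 1, h⟩ := finRotate_of_lt (by omega)

theorem sameCycle_finRotate {k : ℕ} (x y : Fin (k + 1)) : (finRotate (k + 1)).SameCycle x y := by
  refine sameCycle_of_forall_invariant fun u hu => ?_
  let U : ℕ → ℚ := fun i => if h : i < k + 1 then u ⟨i, h⟩ else 0
  have hUu : ∀ x : Fin (k + 1), U x = u x := fun x => dif_pos x.2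
  have hU : ∀ x : Fin (k + 1), u x = U 0 := by
    intro x
    have := eq_of_forall_succ (U := U) (s := 0) (t := k + 1) (fun i _ hi => by
      have := hu ⟨i, by omega⟩
      rw [finRotate_apply_mk hi] at this
      simp only [U, hi, show i < k + 1 by omega, dif_pos, this]) x.1 (Nat.zero_le _) x.2
    rw [← this]
    exact (hUu x).symm
  rw [hU x, hU y]

/-- The 3-cycle exchanges the arcs [m, b) and [b, e) of the rotation, leaving one cycle. -/
theorem sameCycle_triple_mul_finRotate {k : ℕ} {m b e : Fin (k + 1)} (hmb : m < b) (hbe : b < e)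
    (x y : Fin (k + 1)) :
    (swap m b * (swap e b * finRotate (k + 1))).SameCycle x y := by
  refine sameCycle_of_forall_invariant fun u hu => ?_
  rw [mem_invariantFunctions] at hu
  let U : ℕ → ℚ := fun i => if h : i < k + 1 then u ⟨i, h⟩ else 0
  have hUu : ∀ x : Fin (k + 1), U x = u x := fun x => dif_pos x.2
  have hτ : ∀ z, z ≠ m → z ≠ b → z ≠ e → swap m b (swap e b z) = z := by
    intro z h1 h2 h3
    rw [swap_apply_of_ne_of_ne h3 h2, swap_apply_of_ne_of_ne h1 h2]
  have hτm : swap m b (swap e b m) = b := by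
    rw [swap_apply_of_ne_of_ne (hmb.trans hbe).ne hmb.ne, swap_apply_left]
  have hτb : swap m b (swap e b b) = e := by
    rw [swap_apply_right, swap_apply_of_ne_of_ne (hmb.trans hbe).ne' hbe.ne']
  have hτe : swap m b (swap e b e) = m := by
    rw [swap_apply_left, swap_apply_right]
  have step : ∀ i, (h : i + 1 < k + 1) → i + 1 ≠ m → i + 1 ≠ b → i + 1 ≠ e →
      U (i + 1) = U i := by
    intro i h h1 h2 h3
    have := hu ⟨i, by omega⟩
    rw [Perm.mul_apply, Perm.mul_apply, finRotate_apply_mk h, hτ _ (by simpa [Fin.ext_iff] using h1)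
      (by simpa [Fin.ext_iff] using h2) (by simpa [Fin.ext_iff] using h3)] at this
    simp only [U, h, show i < k + 1 by omega, dif_pos, this]
  have jump : ∀ (i : ℕ) (z w : Fin (k + 1)), i + 1 = (z : ℕ) → swap m b (swap e b z) = w →
      U w = U i := by
    intro i z w h1 h2
    have hz := z.2
    have := hu ⟨i, by omega⟩
    rw [Perm.mul_apply, Perm.mul_apply, finRotate_apply_mk (by omega)] at this
    have e1 : (⟨i + 1, by omega⟩ : Fin (k + 1)) = z := Fin.ext h1
    rw [e1, h2] at this
    rw [hUu, this]
    exact (hUu ⟨i, by omega⟩).symm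
  have hm' : (m : ℕ) < b := hmb
  have hb' : (b : ℕ) < e := hbe
  have he' := e.2
  have A0 := eq_of_forall_succ (U := U) (s := 0) (t := m)
    (fun i _ hi => step i (by omega) (by omega) (by omega) (by omega))
  have A1 := eq_of_forall_succ (U := U) (s := m) (t := b)
    (fun i _ hi => step i (by omega) (by omega) (by omega) (by omega))
  have A2 := eq_of_forall_succ (U := U) (s := b) (t := e)
    (fun i _ hi => step i (by omega) (by omega) (by omega) (by omega))
  have A3 := eq_of_forall_succ (U := U) (s := e) (t := k + 1)
    (fun i _ hi => step i (by omega) (by omega) (by omega) (by omega))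
  have B1 : U e = U m := by
    rw [jump (b - 1) b e (by omega) hτb, A1 (b - 1) (by omega) (by omega)]
  have B2 : U m = U b := by
    rw [jump (e - 1) e m (by omega) hτe, A2 (e - 1) (by omega) (by omega)]
  have B3 : ∀ i, i < (m : ℕ) → U i = U m := by
    intro i hi
    rw [A0 i (by omega) hi, B2, jump (m - 1) m b (by omega) hτm,
      A0 (m - 1) (by omega) (by omega)]
  have hall : ∀ x : Fin (k + 1), u x = U m := by
    intro x
    rw [← hUu]
    rcases Nat.lt_or_ge x m with h1 | h1
    · exact B3 x h1
    rcases Nat.lt_or_ge x b with h2 | h2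
    · exact A1 x h1 h2
    rcases Nat.lt_or_ge x e with h3 | h3
    · rw [A2 x h2 h3, B2]
    · rw [A3 x h3 x.2, B1]
  rw [hall x, hall y]

theorem sameCycle_conj {α : Type*} {c : Perm α} (θ : Perm α) (hc : ∀ x y, c.SameCycle x y) :
    ∀ x y, (θ * c * θ⁻¹).SameCycle x y := by
  intro x y
  rw [Perm.sameCycle_conj]
  exact hc _ _

theorem exists_eq_conj_finRotate {k : ℕ} {c : Perm (Fin (k + 2))} (hc : ∀ x y, c.SameCycle x y) :
    ∃ θ : Perm (Fin (k + 2)), c = θ * finRotate (k + 2) * θ⁻¹ := by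
  have hne : ∀ x, c x ≠ x := by
    intro x hx
    obtain ⟨y, hy⟩ := exists_ne x
    obtain ⟨n, hn⟩ := hc x y
    rw [Perm.zpow_apply_eq_self_of_apply_eq_self hx] at hn
    exact hy hn.symm
  have hcyc : c.IsCycle := ⟨0, hne 0, fun y _ => hc 0 y⟩
  have hsupp : c.support = Finset.univ := by
    ext x; simp [hne x]
  have : IsConj (finRotate (k + 2)) c := by
    rw [Perm.isConj_iff_cycleType_eq, hcyc.cycleType, isCycle_finRotate.cycleType, hsupp,
      support_finRotate]
  obtain ⟨θ, hθ⟩ := isConj_iff.mp this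
  exact ⟨θ, hθ.symm⟩

end Gluing

/-! ### Counting involutions by genus, by double counting over full cycles -/

section Counting

open Equiv

open Classical in
/-- The full cycles. -/
def fullCycles (α : Type*) [Fintype α] : Finset (Perm α) :=
  Finset.univ.filter fun c => ∀ x y, c.SameCycle x y

open Classical in
/-- The involutions with at most `f` fixed points whose genus defect relative to `c` is at most
`d`. -/
def involutionsOfDefect {α : Type*} [Fintype α] (c : Perm α) (f d : ℕ) :
    Finset (Perm α) :=
  Finset.univ.filter fun π => (∀ x, π (π x) = x) ∧ 2 * orbitCount π ≤ Fintype.card α + f ∧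
    Fintype.card α + 1 ≤ orbitCount π + orbitCount (c * π) + d

theorem mem_fullCycles {α : Type*} [Fintype α] {c : Perm α} :
    c ∈ fullCycles α ↔ ∀ x y, c.SameCycle x y := by
  simp [fullCycles]

theorem mem_involutionsOfDefect {α : Type*} [Fintype α] {c π : Perm α} {f d : ℕ} :
    π ∈ involutionsOfDefect c f d ↔ (∀ x, π (π x) = x) ∧
      2 * orbitCount π ≤ Fintype.card α + f ∧
      Fintype.card α + 1 ≤ orbitCount π + orbitCount (c * π) + d := by
  simp [involutionsOfDefect]

theorem conj_mem_involutionsOfDefect {α : Type*} [Fintype α] [DecidableEq α] {c π : Perm α}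
    {f d : ℕ} (θ : Perm α) (h : π ∈ involutionsOfDefect c f d) :
    θ * π * θ⁻¹ ∈ involutionsOfDefect (θ * c * θ⁻¹) f d := by
  rw [mem_involutionsOfDefect] at *
  obtain ⟨h1, h2, h3⟩ := h
  refine ⟨fun x => by simp [h1], by rwa [orbitCount_conj], ?_⟩
  have : θ * c * θ⁻¹ * (θ * π * θ⁻¹) = θ * (c * π) * θ⁻¹ := by group
  rwa [this, orbitCount_conj, orbitCount_conj]

theorem card_involutionsOfDefect_conj {α : Type*} [Fintype α] [DecidableEq α] (θ c : Perm α)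
    (f d : ℕ) :
    (involutionsOfDefect (θ * c * θ⁻¹) f d).card = (involutionsOfDefect c f d).card := by
  have key : ∀ (θ c : Perm α), (involutionsOfDefect c f d).card ≤
      (involutionsOfDefect (θ * c * θ⁻¹) f d).card := by
    intro θ c
    refine Finset.card_le_card_of_injOn (fun π => θ * π * θ⁻¹)
      (fun π h => conj_mem_involutionsOfDefect θ h) ?_
    intro π _ π' _ h
    simpa using h
  refine le_antisymm ?_ (key θ c)
  have := key θ⁻¹ (θ * c * θ⁻¹)
  simpa [mul_assoc] using this

/-- After conjugating `c` to the rotation, the triple lowers the defect by two while keeping `π` and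
changing only the full cycle. Since `c` is recovered from `c'` and the triple, this yields an
injective encoding. -/
theorem exists_triple_of_mem {k : ℕ} {c π : Perm (Fin (k + 2))} {f d : ℕ}
    (hc : c ∈ fullCycles (Fin (k + 2))) (hπ : π ∈ involutionsOfDefect c f (d + 2)) :
    ∃ m b e, ∃ c' ∈ fullCycles (Fin (k + 2)), π ∈ involutionsOfDefect c' f d ∧
      c = swap e b * (swap m b * c') := by
  obtain ⟨θ, hθ⟩ := exists_eq_conj_finRotate (mem_fullCycles.mp hc)
  have hπ0 := conj_mem_involutionsOfDefect θ⁻¹ hπ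
  set ρ := θ⁻¹ * π * θ⁻¹⁻¹ with hρ
  have hc0 : θ⁻¹ * c * θ⁻¹⁻¹ = finRotate (k + 2) := by rw [hθ]; group
  rw [hc0] at hπ0
  have hπ' : π = θ * ρ * θ⁻¹ := by rw [hρ]; group
  rw [mem_involutionsOfDefect] at hπ0
  obtain ⟨h1, h2, h3⟩ := hπ0
  rw [Fintype.card_fin] at h2 h3
  rcases Nat.lt_or_ge (orbitCount ρ + orbitCount (finRotate (k + 2) * ρ)) (k + 3) with hlt | hge
  · obtain ⟨m, b, e, hmb, hbe, hσ, hcyc⟩ : ∃ m b e, m < b ∧ b < e ∧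
        (finRotate (k + 2) * ρ) e = b ∧ (finRotate (k + 2) * ρ).SameCycle m e :=
      exists_splitting_triple h1 hlt
    have hs := orbitCount_split_triple hmb.ne hbe.ne (hmb.trans hbe).ne hσ hcyc
    refine ⟨θ m, θ b, θ e, θ * (swap m b * (swap e b * finRotate (k + 2))) * θ⁻¹,
      mem_fullCycles.mpr (sameCycle_conj θ (sameCycle_triple_mul_finRotate hmb hbe)), ?_, ?_⟩
    · rw [hπ']
      refine conj_mem_involutionsOfDefect θ ?_
      rw [mem_involutionsOfDefect, Fintype.card_fin]
      refine ⟨h1, h2, ?_⟩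
      rw [mul_assoc, mul_assoc]
      omega
    · rw [hθ]
      have e1 : ∀ x y, swap (θ x) (θ y) = θ * swap x y * θ⁻¹ := fun x y => by
        rw [Equiv.swap_apply_apply]
      rw [e1, e1]
      have e2 : ∀ x y : Fin (k + 2), ∀ ρ : Perm (Fin (k + 2)), swap x y * (swap x y * ρ) = ρ := by
        intro x y ρ
        rw [← mul_assoc, Equiv.swap_mul_self, one_mul]
      have e3 : θ * swap e b * θ⁻¹ * (θ * swap m b * θ⁻¹ *
          (θ * (swap m b * (swap e b * finRotate (k + 2))) * θ⁻¹)) =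
          θ * (swap e b * (swap m b * (swap m b * (swap e b * finRotate (k + 2))))) * θ⁻¹ := by
        group
      rw [e3, e2, e2]
  -- With no defect to remove, the degenerate triple leaves `c` unchanged.
  · refine ⟨0, 0, 0, c, hc, ?_, by simp [← Perm.one_def]⟩
    rw [hπ', hθ]
    refine conj_mem_involutionsOfDefect θ ?_
    rw [mem_involutionsOfDefect, Fintype.card_fin]
    exact ⟨h1, h2, by omega⟩

theorem sum_card_involutionsOfDefect (k f d : ℕ) :
    ∑ c ∈ fullCycles (Fin (k + 2)), (involutionsOfDefect c f d).card =
      (fullCycles (Fin (k + 2))).card * (involutionsOfDefect (finRotate (k + 2)) f d).card := by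
  rw [Finset.sum_const_nat]
  intro c hc
  obtain ⟨θ, rfl⟩ := exists_eq_conj_finRotate (mem_fullCycles.mp hc)
  exact card_involutionsOfDefect_conj _ _ _ _

/-- The reduction changes the full cycle, so pairs `(c, π)` over all full cycles are counted;
conjugation invariance lets the number of full cycles cancel. -/
theorem card_involutionsOfDefect_add_two (k f d : ℕ) :
    (involutionsOfDefect (finRotate (k + 2)) f (d + 2)).card ≤
      (k + 2) ^ 3 * (involutionsOfDefect (finRotate (k + 2)) f d).card := by
  classical
  have hpos : 0 < (fullCycles (Fin (k + 2))).card :=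
    Finset.card_pos.mpr ⟨finRotate (k + 2), mem_fullCycles.mpr sameCycle_finRotate⟩
  refine Nat.le_of_mul_le_mul_left ?_ hpos
  rw [mul_left_comm, ← sum_card_involutionsOfDefect, ← sum_card_involutionsOfDefect,
    ← Finset.card_sigma, ← Finset.card_sigma]
  let g : (Fin (k + 2) × Fin (k + 2) × Fin (k + 2)) ×
      (Σ _ : Perm (Fin (k + 2)), Perm (Fin (k + 2))) →
      (Σ _ : Perm (Fin (k + 2)), Perm (Fin (k + 2))) :=
    fun p => ⟨swap p.1.2.2 p.1.2.1 * (swap p.1.1 p.1.2.1 * p.2.1), p.2.2⟩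
  have hsub : (fullCycles (Fin (k + 2))).sigma (fun c => involutionsOfDefect c f (d + 2)) ⊆
      ((Finset.univ : Finset (Fin (k + 2) × Fin (k + 2) × Fin (k + 2))) ×ˢ
        (fullCycles (Fin (k + 2))).sigma (fun c => involutionsOfDefect c f d)).image g := by
    rintro ⟨c, π⟩ h
    rw [Finset.mem_sigma] at h
    obtain ⟨m, b, e, c', hc', hπ, hcc⟩ := exists_triple_of_mem h.1 h.2
    refine Finset.mem_image.mpr ⟨((m, b, e), ⟨c', π⟩), ?_, ?_⟩
    · exact Finset.mem_product.mpr ⟨Finset.mem_univ _, Finset.mem_sigma.mpr ⟨hc', hπ⟩⟩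
    · simp only [g]
      simp only at hcc
      rw [← hcc]
  refine (Finset.card_le_card hsub).trans (Finset.card_image_le.trans ?_)
  rw [Finset.card_product, Finset.card_univ]
  simp only [Fintype.card_prod, Fintype.card_fin]
  apply le_of_eq
  ring

/-- Defects of involutions are even: from defect 1, a splitting triple would gain two cycles and
violate the genus inequality for the new full cycle. -/
theorem involutionsOfDefect_one_subset {k f : ℕ} :
    involutionsOfDefect (finRotate (k + 2)) f 1 ⊆ involutionsOfDefect (finRotate (k + 2)) f 0 := by
  intro π h
  rw [mem_involutionsOfDefect, Fintype.card_fin] at *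
  obtain ⟨h1, h2, h3⟩ := h
  refine ⟨h1, h2, ?_⟩
  by_contra hlt
  obtain ⟨m, b, e, hmb, hbe, hσ, hcyc⟩ : ∃ m b e, m < b ∧ b < e ∧
      (finRotate (k + 2) * π) e = b ∧ (finRotate (k + 2) * π).SameCycle m e :=
    exists_splitting_triple h1
      (show orbitCount π + orbitCount (finRotate (k + 2) * π) < k + 3 by omega)
  have hs := orbitCount_split_triple hmb.ne hbe.ne (hmb.trans hbe).ne hσ hcyc
  have := orbitCount_add_le (c := swap m b * (swap e b * finRotate (k + 2)))
    (sameCycle_triple_mul_finRotate hmb hbe) π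
  rw [mul_assoc, mul_assoc, Fintype.card_fin] at this
  omega

theorem card_involutionsOfDefect_le (k f d : ℕ) :
    (involutionsOfDefect (finRotate (k + 2)) f d).card ≤
      (k + 2) ^ (3 * (d / 2)) * (involutionsOfDefect (finRotate (k + 2)) f 0).card := by
  induction d using Nat.twoStepInduction with
  | zero => simp
  | one => simpa using Finset.card_le_card involutionsOfDefect_one_subset
  | more d ih _ =>
    refine (card_involutionsOfDefect_add_two k f d).trans ?_
    refine (Nat.mul_le_mul_left _ ih).trans (le_of_eq ?_)
    rw [show (d + 2) / 2 = d / 2 + 1 by omega]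
    ring

end Counting

/-! ### Genus-zero involutions are noncrossing, and the resulting count of derangements -/

section Noncrossing

open Equiv

theorem sameCycle_finRotate_mul_crossing {k : ℕ} {π : Perm (Fin (k + 1))}
    (h : ∀ x, π (π x) = x) {a c : Fin (k + 1)} (hac : a < c) (hcb : c < π a) (hbd : π a < π c)
    (hfix : ∀ x, x ≠ a → x ≠ c → x ≠ π a → x ≠ π c → π x = x) (x y : Fin (k + 1)) :
    (finRotate (k + 1) * π).SameCycle x y := by
  refine sameCycle_of_forall_invariant fun u hu => ?_
  let U : ℕ → ℚ := fun i => if h : i < k + 1 then u ⟨i, h⟩ else 0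
  have hUu : ∀ x : Fin (k + 1), U x = u x := fun x => dif_pos x.2
  have jump : ∀ (i : ℕ) (z w : Fin (k + 1)), i = (z : ℕ) → i + 1 < k + 1 → π z = w →
      U (i + 1) = U w := by
    intro i z w hi hik hw
    have := hu (π z)
    rw [Perm.mul_apply, h, hw] at this
    have hz : z = ⟨i, by omega⟩ := Fin.ext hi.symm
    rw [hz, finRotate_apply_mk hik] at this
    rw [hUu w, ← this]
    exact hUu ⟨i + 1, hik⟩
  have step : ∀ i, i + 1 < k + 1 → i ≠ a → i ≠ c → i ≠ π a → i ≠ π c → U (i + 1) = U i := by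
    intro i hi h1 h2 h3 h4
    exact jump i ⟨i, by omega⟩ ⟨i, by omega⟩ rfl hi (hfix _ (by simpa [Fin.ext_iff] using h1)
      (by simpa [Fin.ext_iff] using h2) (by simpa [Fin.ext_iff] using h3)
      (by simpa [Fin.ext_iff] using h4))
  have hac' : (a : ℕ) < c := hac
  have hcb' : (c : ℕ) < π a := hcb
  have hbd' : (π a : ℕ) < π c := hbd
  have hd := (π c).2
  have A0 := eq_of_forall_succ (U := U) (s := 0) (t := a + 1)
    (fun i _ hi => step i (by omega) (by omega) (by omega) (by omega) (by omega))
  have A1 := eq_of_forall_succ (U := U) (s := a + 1) (t := c + 1)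
    (fun i _ hi => step i (by omega) (by omega) (by omega) (by omega) (by omega))
  have A2 := eq_of_forall_succ (U := U) (s := c + 1) (t := π a + 1)
    (fun i _ hi => step i (by omega) (by omega) (by omega) (by omega) (by omega))
  have A3 := eq_of_forall_succ (U := U) (s := π a + 1) (t := π c + 1)
    (fun i _ hi => step i (by omega) (by omega) (by omega) (by omega) (by omega))
  have A4 := eq_of_forall_succ (U := U) (s := π c + 1) (t := k + 1)
    (fun i _ hi => step i (by omega) (by omega) (by omega) (by omega) (by omega))
  have B1 : U (a + 1) = U (π a) := jump a a _ rfl (by omega) rfl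
  have B2 : U (π a + 1) = U a := jump _ (π a) _ rfl (by omega) (h a)
  have B3 : U (c + 1) = U (π c) := jump c c _ rfl (by omega) rfl
  have C1 := A0 a (by omega) (by omega)
  have C2 := A1 c (by omega) (by omega)
  have C3 := A2 (π a) (by omega) (by omega)
  have C4 := A3 (π c) (by omega) (by omega)
  have hall : ∀ x : Fin (k + 1), u x = U a := by
    intro x
    rw [← hUu]
    have hx := x.2
    rcases Nat.lt_or_ge x (a + 1) with h1 | h1
    · rw [A0 x (by omega) h1, C1]
    rcases Nat.lt_or_ge x (c + 1) with h2 | h2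
    · rw [A1 x h1 h2, B1, C3, B3, C4, B2]
    rcases Nat.lt_or_ge x (π a + 1) with h3 | h3
    · rw [A2 x h2 h3, B3, C4, B2]
    rcases Nat.lt_or_ge x (π c + 1) with h4 | h4
    · rw [A3 x h3 h4, B2]
    · rw [A4 x h4 x.2, jump _ (π c) _ rfl (by omega) (h c), C2, B1, C3, B3, C4, B2]
  rw [hall x, hall y]

/-- Involutions of genus zero are noncrossing. -/
theorem not_crossing {k : ℕ} {π : Perm (Fin (k + 1))} (h : ∀ x, π (π x) = x)
    (hd : k + 2 ≤ orbitCount π + orbitCount (finRotate (k + 1) * π)) {a c : Fin (k + 1)}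
    (hac : a < c) (hcb : c < π a) (hbd : π a < π c) : False := by
  induction hn : k + 1 - orbitCount π using Nat.strong_induction_on generalizing π with
  | _ n ih =>
  have hlt := card_apply_lt_involution h
  rw [Fintype.card_fin] at hlt
  by_cases hfix : ∀ x, x ≠ a → x ≠ c → x ≠ π a → x ≠ π c → π x = x
  -- If only the two crossing pairs move points, the product with the rotation is a single cycle,
  -- too few for genus zero. Otherwise another 2-cycle is erased: `π` gains a cycle and the product
  -- loses at most one, so genus zero persists.
  · have h1 := finrank_invariantFunctions_le_one
      (sameCycle_finRotate_mul_crossing h hac hcb hbd hfix)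
    have h2 : 0 < (Finset.univ.filter fun i => π i < i).card :=
      Finset.card_pos.mpr ⟨π a, by simpa [h] using hac.trans hcb⟩
    omega
  · push Not at hfix
    obtain ⟨x, xa, xc, xb, xd, hx⟩ := hfix
    have h1 : orbitCount π < orbitCount (swap x (π x) * π) :=
      orbitCount_lt_orbitCount_swap_mul hx.symm (by simp [Perm.SameCycle.refl])
    have h2 := orbitCount_le_orbitCount_swap_mul (finRotate (k + 1) * π) (finRotate (k + 1) x)
      (finRotate (k + 1) (π x))
    have e1 : swap (finRotate (k + 1) x) (finRotate (k + 1) (π x)) * (finRotate (k + 1) * π) =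
        finRotate (k + 1) * (swap x (π x) * π) := by
      rw [← mul_assoc, ← mul_assoc, mul_swap_eq_swap_mul]
    rw [e1] at h2
    have hval : ∀ y, y ≠ x → y ≠ π x → (swap x (π x) * π) y = π y := by
      intro y y1 y2
      rw [Perm.mul_apply, swap_apply_of_ne_of_ne]
      · intro e
        exact y2 (by rw [← e, h])
      · intro e
        exact y1 (π.injective e)
    have hx1 : (swap x (π x) * π) x = x := by simp
    have hx2 : (swap x (π x) * π) (π x) = π x := by simp [h]
    have hinv : ∀ y, (swap x (π x) * π) ((swap x (π x) * π) y) = y := by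
      intro y
      by_cases y1 : y = x
      · rw [y1, hx1, hx1]
      by_cases y2 : y = π x
      · rw [y2, hx2, hx2]
      rw [hval y y1 y2, hval, h]
      · intro e
        exact y2 (by rw [← e, h])
      · intro e
        exact y1 (π.injective e)
    have ha : (swap x (π x) * π) a = π a := hval a xa.symm (fun e => xb (by rw [e, h]))
    have hc : (swap x (π x) * π) c = π c := hval c xc.symm (fun e => xd (by rw [e, h]))
    refine ih _ ?_ hinv (by omega) (by rwa [ha]) (by rwa [ha, hc]) rfl
    have := card_apply_lt_involution hinv
    rw [Fintype.card_fin] at this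
    omega

/-- If `π i < π' i`, the point `π i` also closes a pair of `π'`. Its `π'`-partner cannot lie before
`i` (a crossing), equal `i`, or lie after `i` (there the two involutions already agree). -/
theorem not_lt_of_openers_eq {k : ℕ} {π π' : Perm (Fin (k + 1))}
    (h : ∀ x, π (π x) = x) (h' : ∀ x, π' (π' x) = x)
    (hnc : ∀ a c, a < c → c < π' a → π' a < π' c → False)
    (ho : ∀ x, x < π x ↔ x < π' x) (hf : ∀ x, π x = x ↔ π' x = x) {i : Fin (k + 1)}
    (hi : i < π i) (hmax : ∀ j, i < j → j < π' j → π j = π' j) : ¬ π i < π' i := by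
  intro hlt
  have hb : π' (π i) < π i := by
    have h1 : ¬ π i < π' (π i) := by
      rw [← ho, h]
      exact not_lt.mpr hi.le
    have h2 : π' (π i) ≠ π i := by
      rw [Ne, ← hf, h]
      exact hi.ne
    exact lt_of_le_of_ne (not_lt.mp h1) h2
  rcases lt_trichotomy (π' (π i)) i with h1 | h1 | h1
  · exact hnc _ _ h1 (by rwa [h']) (by rwa [h'])
  · have := congrArg π' h1
    rw [h'] at this
    exact hlt.ne this
  · have h2 := hmax _ h1 (by rwa [h'])
    rw [h'] at h2
    exact h1.ne' (π.injective h2)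

theorem eq_of_openers_eq {k : ℕ} {π π' : Perm (Fin (k + 1))}
    (h : ∀ x, π (π x) = x) (h' : ∀ x, π' (π' x) = x)
    (hnc : ∀ a c, a < c → c < π a → π a < π c → False)
    (hnc' : ∀ a c, a < c → c < π' a → π' a < π' c → False)
    (ho : ∀ x, x < π x ↔ x < π' x) (hf : ∀ x, π x = x ↔ π' x = x) : π = π' := by
  have key : ∀ i, i < π i → π i = π' i := by
    intro i
    induction i using WellFoundedGT.induction with
    | _ i ih =>
    intro hi
    rcases lt_trichotomy (π i) (π' i) with h1 | h1 | h1
    · exact (not_lt_of_openers_eq h h' hnc' ho hf hi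
        (fun j hj hj' => ih j hj ((ho j).mpr hj')) h1).elim
    · exact h1
    · exact (not_lt_of_openers_eq h' h hnc (fun x => (ho x).symm) (fun x => (hf x).symm)
        ((ho i).mp hi) (fun j hj hj' => (ih j hj hj').symm) h1).elim
  ext1 i
  rcases lt_trichotomy i (π i) with h1 | h1 | h1
  · exact key i h1
  · rw [← h1, (hf i).mp h1.symm]
  · have := key (π i) (by rwa [h])
    rw [h] at this
    have h2 := congrArg π' this
    rw [h'] at h2
    exact h2.symm

theorem card_filter_card_le (p f : ℕ) (hp : 0 < p) :
    ((Finset.univ : Finset (Finset (Fin p))).filter fun A => A.card ≤ f).card ≤ 2 * p ^ f := by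
  classical
  let g : Option (Fin f → Fin p) → Finset (Fin p) := fun o =>
    match o with
    | none => ∅
    | some g => Finset.univ.image g
  have hsub : ((Finset.univ : Finset (Finset (Fin p))).filter fun A => A.card ≤ f) ⊆
      Finset.univ.image g := by
    intro A hA
    have hA' := (Finset.mem_filter.mp hA).2
    rw [Finset.mem_image]
    rcases A.eq_empty_or_nonempty with rfl | ⟨x, hx⟩
    · exact ⟨none, Finset.mem_univ _, rfl⟩
    · refine ⟨some fun i => if h : (i : ℕ) < A.card then (A.equivFin.symm ⟨i, h⟩ : Fin p) else x,
        Finset.mem_univ _, ?_⟩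
      ext y
      simp only [g, Finset.mem_image, Finset.mem_univ, true_and]
      constructor
      · rintro ⟨i, rfl⟩
        split_ifs
        · exact Subtype.coe_prop _
        · exact hx
      · intro hy
        refine ⟨⟨A.equivFin ⟨y, hy⟩, (A.equivFin ⟨y, hy⟩).2.trans_le hA'⟩, ?_⟩
        simp
  refine (Finset.card_le_card hsub).trans (Finset.card_image_le.trans ?_)
  rw [Finset.card_univ, Fintype.card_option, Fintype.card_fun, Fintype.card_fin, Fintype.card_fin]
  have : 0 < p ^ f := by positivity
  omega

/-- A noncrossing involution is recovered from its set of openers and its set of fixed points; the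
latter has at most `f` elements. -/
theorem card_involutionsOfDefect_zero_le (k f : ℕ) :
    (involutionsOfDefect (finRotate (k + 1)) f 0).card ≤ 2 ^ (k + 1) * (2 * (k + 1) ^ f) := by
  classical
  have hcard : ((Finset.univ : Finset (Finset (Fin (k + 1)))) ×ˢ
      ((Finset.univ : Finset (Finset (Fin (k + 1)))).filter fun A => A.card ≤ f)).card ≤
      2 ^ (k + 1) * (2 * (k + 1) ^ f) := by
    rw [Finset.card_product, Finset.card_univ, Fintype.card_finset, Fintype.card_fin]
    exact Nat.mul_le_mul_left _ (card_filter_card_le _ _ (by omega))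
  refine le_trans ?_ hcard
  refine Finset.card_le_card_of_injOn
    (fun π => (Finset.univ.filter (fun i => i < π i), Finset.univ.filter (fun i => π i = i))) ?_ ?_
  · intro π hπ
    rw [Finset.mem_coe, mem_involutionsOfDefect] at hπ
    obtain ⟨h1, h2, -⟩ := hπ
    refine Finset.mem_coe.mpr (Finset.mem_product.mpr ⟨Finset.mem_univ _, ?_⟩)
    refine Finset.mem_filter.mpr ⟨Finset.mem_univ _, ?_⟩
    have := two_mul_orbitCount_involution h1
    unfold fixedCount at this
    simp only
    omega
  · intro π hπ π' hπ' he
    rw [Finset.mem_coe, mem_involutionsOfDefect, Fintype.card_fin] at hπ hπ'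
    rw [Prod.mk.injEq, Finset.filter_inj', Finset.filter_inj'] at he
    exact eq_of_openers_eq hπ.1 hπ'.1
      (fun a c h1 h2 h3 => not_crossing hπ.1 (by omega) h1 h2 h3)
      (fun a c h1 h2 h3 => not_crossing hπ'.1 (by omega) h1 h2 h3)
      (fun x => he.1 (Finset.mem_univ x)) (fun x => he.2 (Finset.mem_univ x))

open Classical in
/-- The derangements `π` with `2 #π + #(cπ) + #(cπ⁻¹) + D = 2 |α| + 2`. -/
def derangementsOfDefect {α : Type*} [Fintype α] (c : Perm α) (D : ℕ) : Finset (Perm α) :=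
  Finset.univ.filter fun π => (∀ x, π x ≠ x) ∧
    2 * orbitCount π + orbitCount (c * π) + orbitCount (c * π⁻¹) + D = 2 * Fintype.card α + 2

theorem mem_derangementsOfDefect {α : Type*} [Fintype α] {c π : Perm α} {D : ℕ} :
    π ∈ derangementsOfDefect c D ↔ (∀ x, π x ≠ x) ∧
      2 * orbitCount π + orbitCount (c * π) + orbitCount (c * π⁻¹) + D =
        2 * Fintype.card α + 2 := by
  simp [derangementsOfDefect]

theorem card_derangementsOfDefect_le (k D : ℕ) :
    (derangementsOfDefect (finRotate (k + 2)) D).card ≤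
      2 * 2 ^ (k + 2) * (k + 2) ^ (4 * D) := by
  classical
  let g : (Fin D → Fin (k + 2) × Fin (k + 2)) × Perm (Fin (k + 2)) → Perm (Fin (k + 2)) :=
    fun q => (List.ofFn fun i => swap (q.1 i).1 (q.1 i).2).prod * q.2
  have hsub : derangementsOfDefect (finRotate (k + 2)) D ⊆
      ((Finset.univ : Finset (Fin D → Fin (k + 2) × Fin (k + 2))) ×ˢ
        involutionsOfDefect (finRotate (k + 2)) D (D / 2)).image g := by
    intro π hπ
    obtain ⟨h1, h2⟩ := mem_derangementsOfDefect.mp hπ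
    have hfix : fixedCount π = 0 := by
      simp [fixedCount, h1]
    -- Euler's inequality forces `k + 2 ≤ 2 * orbitCount π + D`, so `D` transpositions suffice to
    -- reach an involution.
    have heul := orbitCount_mul_add_orbitCount_mul_inv_le (c := finRotate (k + 2))
      sameCycle_finRotate π
    obtain ⟨t, π', hinv, hf, hprod, hle⟩ := exists_involution_of_le (c := finRotate (k + 2)) D π
      (by rw [Fintype.card_fin] at *; omega)
    refine Finset.mem_image.mpr ⟨(t, π'), ?_, hprod.symm⟩
    refine Finset.mem_product.mpr ⟨Finset.mem_univ _, mem_involutionsOfDefect.mpr ⟨hinv, ?_, ?_⟩⟩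
    · have := two_mul_orbitCount_involution hinv
      show 2 * orbitCount π' ≤ _
      omega
    · show _ ≤ orbitCount π' + orbitCount (finRotate (k + 2) * π') + _
      have : π'⁻¹ = π' := by
        ext1 x
        rw [Perm.inv_eq_iff_eq, hinv]
      rw [this] at hle
      omega
  refine (Finset.card_le_card hsub).trans (Finset.card_image_le.trans ?_)
  rw [Finset.card_product, Finset.card_univ]
  simp only [Fintype.card_fun, Fintype.card_prod, Fintype.card_fin]
  have h1 := card_involutionsOfDefect_le k D (D / 2)
  have h2 := card_involutionsOfDefect_zero_le (k + 1) D
  calc _ ≤ ((k + 2) * (k + 2)) ^ D * ((k + 2) ^ (3 * (D / 2 / 2)) *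
        (2 ^ (k + 2) * (2 * (k + 2) ^ D))) :=
        Nat.mul_le_mul_left _ (h1.trans (Nat.mul_le_mul_left _ h2))
    _ = 2 * 2 ^ (k + 2) * ((k + 2) ^ (D + D + 3 * (D / 2 / 2) + D)) := by
        rw [mul_pow, pow_add, pow_add, pow_add]; ring
    -- The exponent is 2D for the transpositions, 3⌊D/4⌋ for the handles and D for the fixed points,
    -- at most 4D in all.
    _ ≤ _ := by
        refine Nat.mul_le_mul_left _ (Nat.pow_le_pow_right (by omega) (by omega))

end Noncrossing

/-! ### Summing the weights of derangements over the defect -/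

section WeightSum

open Equiv

open Classical in
/-- The derangements of `Fin q`. -/
def derangementsFinset (q : ℕ) : Finset (Perm (Fin q)) :=
  Finset.univ.filter fun π => ∀ x, π x ≠ x

theorem mem_derangementsFinset {q : ℕ} {π : Perm (Fin q)} :
    π ∈ derangementsFinset q ↔ ∀ x, π x ≠ x := by
  simp [derangementsFinset]

/-- The weight of a permutation in the Gaussian expansion of the trace. -/
def permWeight (l m n : ℕ) {q : ℕ} (π : Perm (Fin q)) : ℕ :=
  l ^ orbitCount π * m ^ orbitCount (finRotate q * π⁻¹) * n ^ orbitCount (finRotate q * π)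

theorem permWeight_le {l m n k : ℕ} (hl : 1 ≤ l) (hn : 1 ≤ n) (hmn : n ≤ m) {a : ℝ}
    (ha : a = (m : ℝ) * n / l) {π : Perm (Fin (k + 2))} {D : ℕ}
    (hπ : π ∈ derangementsOfDefect (finRotate (k + 2)) D) :
    (permWeight l m n π : ℝ) / l ^ (k + 2) ≤
      m * n * √a ^ (k + 2) * (√(max 1 a) / n) ^ D := by
  obtain ⟨h1, h2⟩ := mem_derangementsOfDefect.mp hπ
  have hc : ∀ x y, (finRotate (k + 2)).SameCycle x y := sameCycle_finRotate
  have g1 := orbitCount_add_le hc π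
  have g2 := orbitCount_add_le hc π⁻¹
  have g3 := orbitCount_mul_add_orbitCount_mul_inv_le hc π
  have g4 := two_mul_orbitCount_le π
  have hfix : fixedCount π = 0 := by simp [fixedCount, h1]
  rw [orbitCount_inv] at g2
  rw [Fintype.card_fin] at *
  unfold permWeight
  set A := orbitCount (finRotate (k + 2) * π⁻¹)
  set B := orbitCount (finRotate (k + 2) * π)
  set K := orbitCount π
  -- Here `s` is the excess of `e` over a pairing, and `d₁`, `d₂` are the genus defects of `π⁻¹` and
  -- `π`. Then `D = d₁ + d₂`, and Euler's inequality gives `s ≤ D`, so the powers of `√a` beyond `k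
  -- + 2` are absorbed by `D`.
  obtain ⟨e, he⟩ : ∃ e, e + K = k + 2 := ⟨k + 2 - K, by omega⟩
  obtain ⟨s, hs⟩ : ∃ s, s + (k + 2) = 2 * e := ⟨2 * e - (k + 2), by omega⟩
  obtain ⟨d₁, hd₁⟩ : ∃ d, A + d = e + 1 := ⟨e + 1 - A, by omega⟩
  obtain ⟨d₂, hd₂⟩ : ∃ d, B + d = e + 1 := ⟨e + 1 - B, by omega⟩
  have hD : D = d₁ + d₂ := by omega
  have hsD : s ≤ D := by omega
  have hl' : (0 : ℝ) < l := by exact_mod_cast hl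
  have hn' : (0 : ℝ) < n := by exact_mod_cast hn
  have hmn' : (n : ℝ) ≤ m := by exact_mod_cast hmn
  have hm' : (0 : ℝ) < m := hn'.trans_le hmn'
  have ha0 : 0 ≤ a := by rw [ha]; positivity
  have hM : 1 ≤ √(max 1 a) := by
    rw [Real.one_le_sqrt]; exact le_max_left _ _
  have hsq : a ^ e = √a ^ (k + 2) * √a ^ s := by
    rw [← pow_add, add_comm, hs, pow_mul, Real.sq_sqrt ha0]
  have hle : √a ^ s ≤ √(max 1 a) ^ D :=
    (pow_le_pow_left₀ (Real.sqrt_nonneg _) (Real.sqrt_le_sqrt (le_max_right _ _)) s).trans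
      (pow_le_pow_right₀ hM hsD)
  -- Only here does `n ≤ m` enter: a missing factor `m` is worth at least a factor `n`.
  have hmain : (m : ℝ) ^ A * n ^ B * n ^ D ≤ m * n * (m * n) ^ e := by
    calc (m : ℝ) ^ A * n ^ B * n ^ D = m ^ A * n ^ d₁ * n ^ (B + d₂) := by
          rw [hD, pow_add, pow_add]; ring
      _ ≤ m ^ A * m ^ d₁ * n ^ (B + d₂) := by gcongr
      _ = m * n * (m * n) ^ e := by
          rw [← pow_add, hd₁, hd₂, pow_succ, pow_succ, mul_pow]; ring
  push_cast
  rw [div_pow, mul_div_assoc', div_le_div_iff₀ (by positivity) (by positivity)]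
  have hlk : (l : ℝ) ^ (k + 2) = l ^ e * l ^ K := by rw [← he, pow_add]
  have hae : (m * n : ℝ) ^ e = a ^ e * l ^ e := by
    rw [ha, ← mul_pow, div_mul_cancel₀ _ hl'.ne']
  calc (l : ℝ) ^ K * m ^ A * n ^ B * n ^ D = l ^ K * (m ^ A * n ^ B * n ^ D) := by ring
    _ ≤ l ^ K * (m * n * (m * n) ^ e) := by gcongr
    _ = m * n * √a ^ (k + 2) * √a ^ s * l ^ (k + 2) := by rw [hae, hsq, hlk]; ring
    _ ≤ m * n * √a ^ (k + 2) * √(max 1 a) ^ D * l ^ (k + 2) := by gcongr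

theorem sum_permWeight_le {l m n k : ℕ} (hl : 1 ≤ l) (hn : 1 ≤ n) (hmn : n ≤ m) {a : ℝ}
    (ha : a = (m : ℝ) * n / l)
    (hy : ((k + 2 : ℕ) : ℝ) ^ 4 * (√(max 1 a) / n) ≤ 1 / 2) :
    ∑ π ∈ derangementsFinset (k + 2), (permWeight l m n π : ℝ) / l ^ (k + 2) ≤
      4 * (m * n) * (2 * √a) ^ (k + 2) := by
  classical
  set y := √(max 1 a) / n with hydef
  have hy0 : 0 ≤ y := by positivity
  -- The truncated subtraction is the true defect, because the genus inequalities for `π` and `π⁻¹`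
  -- bound the subtracted sum by `2 * (k + 2) + 2`.
  have hmaps : ∀ π ∈ derangementsFinset (k + 2),
      (2 * (k + 2) + 2 - (2 * orbitCount π + orbitCount (finRotate (k + 2) * π) +
        orbitCount (finRotate (k + 2) * π⁻¹))) ∈ Finset.range (2 * (k + 2) + 3) := by
    intro π _
    rw [Finset.mem_range]
    omega
  rw [← Finset.sum_fiberwise_of_maps_to hmaps]
  have hD : ∀ D ∈ Finset.range (2 * (k + 2) + 3),
      ∑ π ∈ derangementsFinset (k + 2) with (2 * (k + 2) + 2 - (2 * orbitCount π +
        orbitCount (finRotate (k + 2) * π) + orbitCount (finRotate (k + 2) * π⁻¹))) = D,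
        (permWeight l m n π : ℝ) / l ^ (k + 2) ≤
      2 * (m * n) * (2 * √a) ^ (k + 2) * (1 / 2) ^ D := by
    intro D _
    have hsub : ∀ π ∈ (derangementsFinset (k + 2)).filter (fun π =>
        (2 * (k + 2) + 2 - (2 * orbitCount π +
        orbitCount (finRotate (k + 2) * π) + orbitCount (finRotate (k + 2) * π⁻¹))) = D),
        π ∈ derangementsOfDefect (finRotate (k + 2)) D := by
      intro π hπ
      rw [Finset.mem_filter, mem_derangementsFinset] at hπ
      refine mem_derangementsOfDefect.mpr ⟨hπ.1, ?_⟩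
      have hc : ∀ x y, (finRotate (k + 2)).SameCycle x y := sameCycle_finRotate
      have g1 := orbitCount_add_le hc π
      have g2 := orbitCount_add_le hc π⁻¹
      rw [orbitCount_inv] at g2
      have := hπ.2
      rw [Fintype.card_fin] at *
      omega
    calc _ ≤ ∑ π ∈ (derangementsFinset (k + 2)).filter (fun π =>
        (2 * (k + 2) + 2 - (2 * orbitCount π +
        orbitCount (finRotate (k + 2) * π) + orbitCount (finRotate (k + 2) * π⁻¹))) = D),
          m * n * √a ^ (k + 2) * y ^ D :=
          Finset.sum_le_sum fun π hπ => permWeight_le hl hn hmn ha (hsub π hπ)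
      _ ≤ (2 * 2 ^ (k + 2) * (k + 2 : ℕ) ^ (4 * D)) * (m * n * √a ^ (k + 2) * y ^ D) := by
          rw [Finset.sum_const, nsmul_eq_mul]
          gcongr
          have := (Finset.card_le_card hsub).trans (card_derangementsOfDefect_le k D)
          exact_mod_cast this
      _ = 2 * (m * n) * (2 * √a) ^ (k + 2) * (((k + 2 : ℕ) : ℝ) ^ 4 * y) ^ D := by
          rw [mul_pow, mul_pow, pow_mul]; ring
      _ ≤ _ := by gcongr
  refine (Finset.sum_le_sum hD).trans ?_
  rw [← Finset.mul_sum]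
  have := sum_geometric_two_le (2 * (k + 2) + 3)
  calc _ ≤ 2 * (m * n) * (2 * √a) ^ (k + 2) * 2 := by gcongr
    _ = _ := by ring

end WeightSum

/-! ### Wick's formula for complex Gaussian monomials -/

section Wick

open Equiv Complex

theorem integrable_norm_pow_mul_exp (a : ℕ) :
    Integrable (fun z : ℂ => ‖z‖ ^ a * Real.exp (-‖z‖ ^ 2)) := by
  refine Integrable.of_integral_ne_zero ?_
  have := Complex.integral_rpow_mul_exp_neg_rpow (p := 2) (q := a) (by norm_num)
    (by have : (0 : ℝ) ≤ a := by positivity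
        linarith)
  simp only [Real.rpow_natCast, Real.rpow_ofNat] at this
  rw [this]
  have h0 : 0 < Real.Gamma ((a + 2) / 2) := Real.Gamma_pos_of_pos (by positivity)
  positivity

/-- The mixed monomial against the Gaussian density. -/
def gaussMonomial (a b : ℕ) (z : ℂ) : ℂ :=
  z ^ a * (starRingEnd ℂ z) ^ b * (Real.exp (-‖z‖ ^ 2) : ℝ)

theorem continuous_gaussMonomial (a b : ℕ) : Continuous (gaussMonomial a b) := by
  unfold gaussMonomial
  have : Continuous fun z : ℂ => starRingEnd ℂ z := Complex.continuous_conj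
  fun_prop

theorem integrable_gaussMonomial (a b : ℕ) : Integrable (gaussMonomial a b) := by
  refine (integrable_norm_pow_mul_exp (a + b)).mono'
    (continuous_gaussMonomial a b).aestronglyMeasurable ?_
  refine Filter.Eventually.of_forall fun z => le_of_eq ?_
  simp only [gaussMonomial, norm_mul, norm_pow, RCLike.norm_conj, Complex.norm_real,
    Real.norm_eq_abs, Real.abs_exp, pow_add]

theorem integral_gaussMonomial (a b : ℕ) :
    ∫ z, gaussMonomial a b z = if a = b then ((Real.pi * a.factorial : ℝ) : ℂ) else 0 := by
  split_ifs with h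
  · subst h
    have e : ∀ z, gaussMonomial a a z = ((‖z‖ ^ (2 * a) * Real.exp (-‖z‖ ^ 2) : ℝ) : ℂ) := by
      intro z
      rw [gaussMonomial, ← mul_pow, Complex.mul_conj, Complex.normSq_eq_norm_sq, pow_mul]
      push_cast
      rfl
    simp_rw [e]
    rw [integral_complex_ofReal]
    have := Complex.integral_rpow_mul_exp_neg_rpow (p := 2) (q := (2 * a : ℕ)) (by norm_num)
      (by have : (0 : ℝ) ≤ (2 * a : ℕ) := by positivity
          linarith)
    simp only [Real.rpow_natCast, Real.rpow_ofNat] at this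
    rw [this]
    have h2 : (((2 * a : ℕ) : ℝ) + 2) / 2 = a + 1 := by push_cast; ring
    rw [h2, Real.Gamma_nat_eq_factorial]
    congr 2
    ring
  -- Rotation by this angle preserves the measure and changes the sign of the monomial.
  · set θ : ℝ := Real.pi / ((a : ℝ) - b) with hθ
    have hab : ((a : ℝ) - b) ≠ 0 := by
      rw [sub_ne_zero]
      exact_mod_cast h
    let ω : Circle := Circle.exp θ
    have hmp : MeasurePreserving (rotation ω) (volume : Measure ℂ) volume :=
      LinearIsometryEquiv.measurePreserving _
    have h1 : ∫ z, gaussMonomial a b (rotation ω z) = ∫ z, gaussMonomial a b z :=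
      hmp.integral_comp (rotation ω).toHomeomorph.measurableEmbedding _
    have h2 : ∀ z, gaussMonomial a b (rotation ω z) = -gaussMonomial a b z := by
      intro z
      have hω : (ω : ℂ) ^ a * (starRingEnd ℂ (ω : ℂ)) ^ b = -1 := by
        have e1 : (ω : ℂ) = Complex.exp (θ * I) := Circle.coe_exp θ
        rw [e1, ← Complex.exp_conj, ← Complex.exp_nat_mul, ← Complex.exp_nat_mul,
          ← Complex.exp_add, ← Complex.exp_pi_mul_I]
        congr 1
        have : ((a : ℂ) - b) * θ = Real.pi := by
          rw [hθ]
          push_cast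
          have : ((a : ℂ) - b) ≠ 0 := by exact_mod_cast hab
          field_simp
        simp only [map_mul, Complex.conj_ofReal, Complex.conj_I]
        linear_combination I * this
      simp only [gaussMonomial, rotation_apply, norm_mul, Circle.norm_coe, one_mul, map_mul,
        mul_pow]
      linear_combination (z ^ a * (starRingEnd ℂ) z ^ b * (Real.exp (-‖z‖ ^ 2) : ℝ)) * hω
    simp_rw [h2] at h1
    rw [integral_neg] at h1
    have : (2 : ℂ) * ∫ z, gaussMonomial a b z = 0 := by linear_combination -h1
    simpa using this

variable {κ T : Type*} [Fintype κ] [DecidableEq κ] [Fintype T] [DecidableEq T]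

/-- The (unnormalised) Gaussian density on `κ → ℂ`. -/
def gaussWeight (v : κ → ℂ) : ℂ := ∏ i, ((Real.exp (-‖v i‖ ^ 2) : ℝ) : ℂ)

theorem prod_monomial_mul_gaussWeight (α β : T → κ) (v : κ → ℂ) :
    (∏ t, v (α t) * starRingEnd ℂ (v (β t))) * gaussWeight v =
      ∏ i, gaussMonomial (Fintype.card {t // α t = i}) (Fintype.card {t // β t = i}) (v i) := by
  have key : ∀ (γ : T → κ) (f : κ → ℂ), ∏ t, f (γ t) =
      ∏ i, f i ^ Fintype.card {t // γ t = i} := by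
    intro γ f
    rw [← Finset.prod_fiberwise Finset.univ γ]
    refine Finset.prod_congr rfl fun i _ => ?_
    rw [Fintype.card_subtype, ← Finset.prod_const]
    refine Finset.prod_congr rfl fun t ht => ?_
    rw [(Finset.mem_filter.mp ht).2]
  unfold gaussMonomial gaussWeight
  rw [Finset.prod_mul_distrib, key α v, key β (fun i => starRingEnd ℂ (v i)),
    Finset.prod_mul_distrib, Finset.prod_mul_distrib]

theorem integrable_monomial (α β : T → κ) :
    Integrable fun v : κ → ℂ =>
      (∏ t, v (α t) * starRingEnd ℂ (v (β t))) * gaussWeight v := by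
  simp_rw [prod_monomial_mul_gaussWeight]
  exact Integrable.fintype_prod (fun i => integrable_gaussMonomial _ _)

/-- The matchings, when there are any, form a torsor under the stabiliser of `α`, whose order is a
product of factorials. -/
theorem card_matching (α β : T → κ) :
    (Nat.card {π : Perm T // ∀ t, β t = α (π t)} : ℂ) =
      ∏ i, if Fintype.card {t // α t = i} = Fintype.card {t // β t = i} then
        ((Fintype.card {t // α t = i}).factorial : ℂ) else 0 := by
  by_cases h : ∀ i, Fintype.card {t // α t = i} = Fintype.card {t // β t = i}
  · have hex : ∃ π₀ : Perm T, ∀ t, β t = α (π₀ t) := by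
      refine ⟨Equiv.ofFiberEquiv (f := β) (g := α) fun i => (Fintype.equivOfCardEq (h i).symm), ?_⟩
      intro t
      exact (Equiv.ofFiberEquiv_map _ t).symm
    obtain ⟨π₀, hπ₀⟩ := hex
    have e : {π : Perm T // ∀ t, β t = α (π t)} ≃ {g : Perm T // α ∘ g = α} :=
      { toFun := fun π => ⟨π.1 * π₀⁻¹, by
          funext t
          have h1 := π.2 (π₀⁻¹ t)
          have h2 := hπ₀ (π₀⁻¹ t)
          rw [show π₀ (π₀⁻¹ t) = t by simp] at h2
          simp only [Function.comp, Perm.mul_apply]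
          rw [← h1, h2]⟩
        invFun := fun g => ⟨g.1 * π₀, by
          intro t
          rw [hπ₀, Perm.mul_apply]
          exact (congrFun g.2 (π₀ t)).symm⟩
        left_inv := fun π => by simp
        right_inv := fun g => by simp }
    rw [Nat.card_congr e, Nat.card_eq_fintype_card, DomMulAct.stabilizer_card]
    push_cast
    exact Finset.prod_congr rfl fun i _ => (if_pos (h i)).symm
  · push Not at h
    obtain ⟨i, hi⟩ := h
    rw [Finset.prod_eq_zero (Finset.mem_univ i) (if_neg hi)]
    have : IsEmpty {π : Perm T // ∀ t, β t = α (π t)} := by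
      refine ⟨fun ⟨π, hπ⟩ => hi ?_⟩
      exact (Fintype.card_congr (π.subtypeEquiv fun t => by rw [hπ t])).symm
    simp

/-- Wick's formula for complex Gaussian vectors. -/
theorem integral_monomial (α β : T → κ) :
    ∫ v : κ → ℂ, (∏ t, v (α t) * starRingEnd ℂ (v (β t))) * gaussWeight v =
      (Real.pi : ℂ) ^ Fintype.card κ * Nat.card {π : Perm T // ∀ t, β t = α (π t)} := by
  simp_rw [prod_monomial_mul_gaussWeight]
  rw [integral_fintype_prod_volume_eq_prod, card_matching, ← Finset.card_univ,
    ← Finset.prod_const, ← Finset.prod_mul_distrib]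
  refine Finset.prod_congr rfl fun i _ => ?_
  rw [integral_gaussMonomial]
  split_ifs <;> simp

end Wick

/-! ### Wick's formula for centered products: only derangements survive -/

section CenteredWick

open Equiv Complex

variable {κ T : Type*} [Fintype κ] [DecidableEq κ] [Fintype T] [DecidableEq T]

theorem prod_neg_indicator (α β : T → κ) (u : Finset T) :
    ∏ t ∈ u, (-(if α t = β t then 1 else 0 : ℂ)) =
      (-1) ^ u.card * if ∀ t ∈ u, α t = β t then 1 else 0 := by
  rw [Finset.prod_neg, Finset.prod_ite_zero]
  simp

/-- Choosing the delta term at every position in `u` amounts to pairing those positions with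
themselves. -/
theorem card_perm_fixing (α β : T → κ) (u : Finset T) :
    (if ∀ t ∈ u, α t = β t then (1 : ℂ) else 0) *
      Nat.card {π : Perm {t // t ∉ u} // ∀ t : {t // t ∉ u}, β t = α (π t)} =
      ∑ π : Perm T, if (∀ t, β t = α (π t)) ∧ ∀ t ∈ u, π t = t then 1 else 0 := by
  rw [Finset.sum_boole, ← Fintype.card_subtype, ← Nat.card_eq_fintype_card]
  split_ifs with h
  · rw [one_mul]
    congr 1
    refine Nat.card_congr ?_
    refine ((Perm.subtypeEquivSubtypePerm (fun t => t ∉ u)).subtypeEquiv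
      (q := fun f => ∀ t, β t = α (f.1 t)) ?_).trans
      { toFun := fun f => ⟨f.1.1, f.2, fun t ht => f.1.2 t (by simpa using ht)⟩
        invFun := fun f => ⟨⟨f.1, fun t ht => f.2.2 t (by simpa using ht)⟩, f.2.1⟩
        left_inv := fun _ => rfl
        right_inv := fun _ => rfl }
    intro π
    constructor
    · intro hπ t
      by_cases ht : t ∈ u
      · rw [Perm.subtypeEquivSubtypePerm_apply_of_not_mem π (by simpa using ht), h t ht]
      · rw [Perm.subtypeEquivSubtypePerm_apply_of_mem π ht]
        exact hπ ⟨t, ht⟩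
    · intro hπ t
      have := hπ t
      rwa [Perm.subtypeEquivSubtypePerm_apply_of_mem π t.2] at this
  · rw [zero_mul]
    symm
    rw [Nat.cast_eq_zero]
    have : IsEmpty {π : Perm T // (∀ t, β t = α (π t)) ∧ ∀ t ∈ u, π t = t} := by
      refine ⟨fun ⟨π, h1, h2⟩ => h fun t ht => ?_⟩
      rw [h1, h2 t ht]
    simp

theorem centered_prod_expand (α β : T → κ) (v : κ → ℂ) :
    (∏ t, (v (α t) * starRingEnd ℂ (v (β t)) - if α t = β t then 1 else 0)) * gaussWeight v =
      ∑ u : Finset T, ((-1) ^ u.card * if ∀ t ∈ u, α t = β t then (1 : ℂ) else 0) *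
        ((∏ t : {t // t ∉ u}, v (α t) * starRingEnd ℂ (v (β t))) * gaussWeight v) := by
  simp_rw [sub_eq_neg_add]
  rw [Finset.prod_add, Finset.sum_mul, Finset.powerset_univ]
  refine Finset.sum_congr rfl fun u _ => ?_
  rw [prod_neg_indicator, mul_assoc]
  congr 2
  rw [← Finset.compl_eq_univ_sdiff]
  exact Finset.prod_subtype _ (fun t => Finset.mem_compl) _

theorem integrable_centered_prod (α β : T → κ) :
    Integrable fun v : κ → ℂ =>
      (∏ t, (v (α t) * starRingEnd ℂ (v (β t)) - if α t = β t then 1 else 0)) * gaussWeight v := by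
  simp_rw [centered_prod_expand]
  refine integrable_finsetSum _ fun u _ => Integrable.const_mul ?_ _
  exact integrable_monomial (fun t : {t // t ∉ u} => α t) (fun t => β t)

/-- Each matching permutation acquires the alternating sum over subsets of its fixed points, which
is zero unless there are none. -/
theorem integral_centered_prod (α β : T → κ) :
    ∫ v : κ → ℂ, (∏ t, (v (α t) * starRingEnd ℂ (v (β t)) - if α t = β t then 1 else 0)) *
      gaussWeight v =
      (Real.pi : ℂ) ^ Fintype.card κ *
        ∑ π : Perm T, if (∀ t, β t = α (π t)) ∧ ∀ t, π t ≠ t then 1 else 0 := by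
  simp_rw [centered_prod_expand]
  rw [integral_finsetSum _ fun u _ => (Integrable.const_mul
    (integrable_monomial (fun t : {t // t ∉ u} => α t) (fun t => β t)) _)]
  simp_rw [integral_const_mul]
  have h1 : ∀ u : Finset T, ∫ v : κ → ℂ, (∏ t : {t // t ∉ u},
      v (α t) * starRingEnd ℂ (v (β t))) * gaussWeight v = (Real.pi : ℂ) ^ Fintype.card κ *
        Nat.card {π : Perm {t // t ∉ u} // ∀ t : {t // t ∉ u}, β t = α (π t)} := fun u =>
    integral_monomial (fun t : {t // t ∉ u} => α t) (fun t => β t)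
  have h2 : ∀ u : Finset T, ((-1) ^ u.card * if ∀ t ∈ u, α t = β t then (1 : ℂ) else 0) *
      ∫ v : κ → ℂ, (∏ t : {t // t ∉ u},
        v (α t) * starRingEnd ℂ (v (β t))) * gaussWeight v =
      (Real.pi : ℂ) ^ Fintype.card κ * ∑ π : Perm T,
        if (∀ t, β t = α (π t)) ∧ ∀ t ∈ u, π t = t then (-1) ^ u.card else 0 := by
    intro u
    have h3 := card_perm_fixing α β u
    have h4 : ∑ π : Perm T, (if (∀ t, β t = α (π t)) ∧ ∀ t ∈ u, π t = t then
        (-1 : ℂ) ^ u.card else 0) = (-1) ^ u.card *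
        ∑ π : Perm T, if (∀ t, β t = α (π t)) ∧ ∀ t ∈ u, π t = t then 1 else 0 := by
      rw [Finset.mul_sum]
      refine Finset.sum_congr rfl fun π _ => ?_
      split_ifs <;> simp
    rw [h1, h4, ← h3]
    ring
  rw [Finset.sum_congr rfl fun u _ => h2 u, ← Finset.mul_sum, Finset.sum_comm]
  congr 1
  refine Finset.sum_congr rfl fun π _ => ?_
  by_cases hπ : ∀ t, β t = α (π t)
  · simp only [hπ, implies_true, true_and]
    rw [← Finset.sum_filter]
    have hfil : (Finset.univ.filter fun u : Finset T => ∀ t ∈ u, π t = t) =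
        (Finset.univ.filter fun t => π t = t).powerset := by
      ext u
      simp [Finset.subset_iff]
    rw [hfil]
    have h5 := Finset.sum_powerset_neg_one_pow_card (x := Finset.univ.filter fun t => π t = t)
    have h6 : (∑ u ∈ (Finset.univ.filter fun t => π t = t).powerset, (-1 : ℂ) ^ u.card) =
        ((if (Finset.univ.filter fun t => π t = t) = ∅ then 1 else 0 : ℤ) : ℂ) := by
      rw [← h5]
      push_cast
      rfl
    rw [h6]
    simp [Finset.filter_eq_empty_iff]
  · simp only [hπ, false_and, if_false, Finset.sum_const_zero]

end CenteredWick

/-! ### Traces of matrix powers as sums over closed walks -/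

section TraceExpansion

variable {ι : Type*} [Fintype ι] [DecidableEq ι]

theorem matrix_pow_succ_apply {R : Type*} [CommRing R] (M : Matrix ι ι R) (q : ℕ) (a b : ι) :
    (M ^ (q + 1)) a b = ∑ i : Fin q → ι, ∏ t : Fin (q + 1),
      M (Fin.cons (α := fun _ => ι) a i t) (Fin.snoc (α := fun _ => ι) i b t) := by
  induction q generalizing a with
  | zero => simp [Fin.snoc]
  | succ q ih =>
    rw [pow_succ', Matrix.mul_apply]
    simp_rw [ih, Finset.mul_sum]
    rw [← Finset.sum_product', ← (Fin.consEquiv (fun _ : Fin (q + 1) => ι)).sum_comp]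
    rw [Finset.univ_product_univ]
    refine Finset.sum_congr rfl fun p _ => ?_
    have hcs := Fin.cons_snoc_eq_snoc_cons p.1 p.2 b
    show M a p.1 * ∏ t, M (Fin.cons (α := fun _ => ι) p.1 p.2 t)
        (Fin.snoc (α := fun _ => ι) p.2 b t) =
      ∏ t, M (Fin.cons (α := fun _ => ι) a (Fin.cons (α := fun _ => ι) p.1 p.2) t)
        (Fin.snoc (α := fun _ => ι) (Fin.cons (α := fun _ => ι) p.1 p.2) b t)
    rw [← hcs]
    symm
    rw [Fin.prod_univ_succ]
    simp only [Fin.cons_zero, Fin.cons_succ]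

theorem trace_pow_succ {R : Type*} [CommRing R] (M : Matrix ι ι R) (q : ℕ) :
    (M ^ (q + 1)).trace = ∑ i : Fin (q + 1) → ι, ∏ t, M (i t) (i (finRotate (q + 1) t)) := by
  rw [Matrix.trace]
  simp_rw [Matrix.diag_apply, matrix_pow_succ_apply]
  rw [← Finset.sum_product', ← (Fin.consEquiv (fun _ : Fin (q + 1) => ι)).sum_comp,
    Finset.univ_product_univ]
  refine Finset.sum_congr rfl fun p _ => Finset.prod_congr rfl fun t _ => ?_
  rw [Fin.snoc_eq_cons_rotate]
  rfl

end TraceExpansion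

/-! ### The Gaussian trace moment as a sum over derangements -/

section GaussianTrace

open Equiv

variable {l m n : ℕ}

/-- The partial transpose of the unnormalised reduced state, as a function of the coordinates. -/
def ptGram (v : Fin l × Fin m × Fin n → ℂ) : Matrix (Fin m × Fin n) (Fin m × Fin n) ℂ :=
  Matrix.of fun i j => ∑ z, v (z, i.1, j.2) * starRingEnd ℂ (v (z, j.1, i.2))

/-- The matching condition decouples: the `l`-indices are constant on cycles of `π`, the `m`-indices
on those of `finRotate q * π⁻¹`, the `n`-indices on those of `finRotate q * π`. The transpose is
what sends `π` and `π⁻¹` to different factors. -/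
theorem card_index_matching {q : ℕ} (π : Perm (Fin q)) :
    Nat.card {p : (Fin q → Fin m × Fin n) × (Fin q → Fin l) //
      ∀ t, ((p.2 t, (p.1 (finRotate q t)).1, (p.1 t).2) : Fin l × Fin m × Fin n) =
        (p.2 (π t), (p.1 (π t)).1, (p.1 (finRotate q (π t))).2)} = permWeight l m n π := by
  have e : {p : (Fin q → Fin m × Fin n) × (Fin q → Fin l) //
      ∀ t, ((p.2 t, (p.1 (finRotate q t)).1, (p.1 t).2) : Fin l × Fin m × Fin n) =
        (p.2 (π t), (p.1 (π t)).1, (p.1 (finRotate q (π t))).2)} ≃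
      ({u : Fin q → Fin l // ∀ i, u (π i) = u i} ×
        {u : Fin q → Fin m // ∀ i, u ((finRotate q * π⁻¹) i) = u i}) ×
        {u : Fin q → Fin n // ∀ i, u ((finRotate q * π) i) = u i} :=
    { toFun := fun p => ((⟨p.1.2, fun t => by
          have := p.2 t
          rw [Prod.mk.injEq] at this
          exact this.1.symm⟩, ⟨fun t => (p.1.1 t).1, fun t => by
          have := p.2 (π⁻¹ t)
          rw [Prod.mk.injEq, Prod.mk.injEq, show π (π⁻¹ t) = t by simp] at this
          exact this.2.1⟩), ⟨fun t => (p.1.1 t).2, fun t => by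
          have := p.2 t
          rw [Prod.mk.injEq, Prod.mk.injEq] at this
          exact this.2.2.symm⟩)
      invFun := fun r => ⟨(fun t => (r.1.2.1 t, r.2.1 t), r.1.1.1), fun t => by
          rw [Prod.mk.injEq, Prod.mk.injEq]
          refine ⟨(r.1.1.2 t).symm, ?_, (r.2.2 t).symm⟩
          have := r.1.2.2 (π t)
          rw [Perm.mul_apply, show π⁻¹ (π t) = t by simp] at this
          exact this⟩
      left_inv := fun p => rfl
      right_inv := fun r => rfl }
  rw [Nat.card_congr e, Nat.card_prod, Nat.card_prod, card_invariant, card_invariant,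
    card_invariant]
  simp [permWeight]

/-- The identity is spread evenly over the `l` summands, so that each one is centered on its own. -/
theorem centered_ptGram_apply (hl : 1 ≤ l) (v : Fin l × Fin m × Fin n → ℂ)
    (i j : Fin m × Fin n) :
    ((l : ℂ)⁻¹ • ptGram v - 1) i j = (l : ℂ)⁻¹ * ∑ z : Fin l,
      (v (z, i.1, j.2) * starRingEnd ℂ (v (z, j.1, i.2)) -
        if ((z, i.1, j.2) : Fin l × Fin m × Fin n) = (z, j.1, i.2) then 1 else 0) := by
  have hl' : (l : ℂ) ≠ 0 := by
    have : l ≠ 0 := by omega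
    exact_mod_cast this
  have h1 : ∀ z : Fin l, ((z, i.1, j.2) : Fin l × Fin m × Fin n) = (z, j.1, i.2) ↔ i = j := by
    intro z
    rw [Prod.mk.injEq, Prod.mk.injEq, Prod.ext_iff]
    simp [eq_comm]
  simp only [h1]
  rw [Finset.sum_sub_distrib, Finset.sum_const, Finset.card_univ, Fintype.card_fin, mul_sub,
    nsmul_eq_mul, ← mul_assoc, inv_mul_cancel₀ hl', one_mul, Matrix.sub_apply, Matrix.smul_apply,
    smul_eq_mul, Matrix.one_apply, ptGram, Matrix.of_apply]

theorem trace_centered_ptGram_pow (hl : 1 ≤ l) (v : Fin l × Fin m × Fin n → ℂ) (q : ℕ) :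
    (((l : ℂ)⁻¹ • ptGram v - 1) ^ (q + 1)).trace = ((l : ℂ) ^ (q + 1))⁻¹ *
      ∑ p : (Fin (q + 1) → Fin m × Fin n) × (Fin (q + 1) → Fin l), ∏ t,
        (v (p.2 t, (p.1 t).1, (p.1 (finRotate (q + 1) t)).2) *
          starRingEnd ℂ (v (p.2 t, (p.1 (finRotate (q + 1) t)).1, (p.1 t).2)) -
        if ((p.2 t, (p.1 t).1, (p.1 (finRotate (q + 1) t)).2) : Fin l × Fin m × Fin n) =
          (p.2 t, (p.1 (finRotate (q + 1) t)).1, (p.1 t).2) then 1 else 0) := by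
  rw [trace_pow_succ, ← Finset.univ_product_univ, Finset.sum_product, Finset.mul_sum]
  refine Finset.sum_congr rfl fun i _ => ?_
  simp_rw [centered_ptGram_apply hl]
  rw [Finset.prod_mul_distrib, Finset.prod_const, Finset.card_univ, Fintype.card_fin, inv_pow,
    Finset.prod_univ_sum]
  simp

theorem integrable_trace_centered_ptGram_pow (hl : 1 ≤ l) (q : ℕ) :
    Integrable fun v : Fin l × Fin m × Fin n → ℂ =>
      (((l : ℂ)⁻¹ • ptGram v - 1) ^ (q + 1)).trace * gaussWeight v := by
  simp_rw [trace_centered_ptGram_pow hl, mul_assoc, Finset.sum_mul]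
  refine Integrable.const_mul (integrable_finsetSum _ fun p _ => ?_) _
  exact integrable_centered_prod
    (fun t => (p.2 t, (p.1 t).1, (p.1 (finRotate (q + 1) t)).2))
    (fun t => (p.2 t, (p.1 (finRotate (q + 1) t)).1, (p.1 t).2))

theorem integral_trace_centered_ptGram_pow (hl : 1 ≤ l) (q : ℕ) :
    ∫ v : Fin l × Fin m × Fin n → ℂ,
      (((l : ℂ)⁻¹ • ptGram v - 1) ^ (q + 1)).trace * gaussWeight v =
      (Real.pi : ℂ) ^ (l * (m * n)) *
        ((∑ π ∈ derangementsFinset (q + 1), (permWeight l m n π : ℝ) / l ^ (q + 1) : ℝ) : ℂ) := by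
  simp_rw [trace_centered_ptGram_pow hl, mul_assoc, Finset.sum_mul]
  rw [integral_const_mul, integral_finsetSum _ fun p _ => integrable_centered_prod
    (fun t => (p.2 t, (p.1 t).1, (p.1 (finRotate (q + 1) t)).2))
    (fun t => (p.2 t, (p.1 (finRotate (q + 1) t)).1, (p.1 t).2))]
  rw [Finset.sum_congr rfl fun p _ => integral_centered_prod
    (fun t => (p.2 t, (p.1 t).1, (p.1 (finRotate (q + 1) t)).2))
    (fun t => (p.2 t, (p.1 (finRotate (q + 1) t)).1, (p.1 t).2))]
  rw [← Finset.mul_sum, Finset.sum_comm]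
  have hπ : ∀ π : Perm (Fin (q + 1)),
      (∑ p : (Fin (q + 1) → Fin m × Fin n) × (Fin (q + 1) → Fin l),
        if (∀ t, ((p.2 t, (p.1 (finRotate (q + 1) t)).1, (p.1 t).2) : Fin l × Fin m × Fin n) =
          (p.2 (π t), (p.1 (π t)).1, (p.1 (finRotate (q + 1) (π t))).2)) ∧ ∀ t, π t ≠ t
        then (1 : ℂ) else 0) = if ∀ t, π t ≠ t then (permWeight l m n π : ℂ) else 0 := by
    intro π
    by_cases h : ∀ t, π t ≠ t
    · rw [if_pos h, ← card_index_matching, Nat.card_eq_fintype_card, Fintype.card_subtype]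
      simp [h]
    · simp [h]
  trans ((l : ℂ) ^ (q + 1))⁻¹ * ((Real.pi : ℂ) ^ Fintype.card (Fin l × Fin m × Fin n) *
    ∑ π : Perm (Fin (q + 1)), if ∀ t, π t ≠ t then (permWeight l m n π : ℂ) else 0)
  · congr 2
    refine Finset.sum_congr rfl fun π _ => ?_
    convert hπ π
  rw [← Finset.sum_filter]
  have hset : (Finset.univ.filter fun π : Perm (Fin (q + 1)) => ∀ t, π t ≠ t) =
      derangementsFinset (q + 1) := by
    ext π
    simp [mem_derangementsFinset]
  rw [hset]
  simp only [Fintype.card_prod, Fintype.card_fin]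
  push_cast
  rw [← Finset.sum_div, mul_left_comm, div_eq_inv_mul]

end GaussianTrace

/-! ### Convexity of even trace moments in the scale -/

section Convexity

theorem re_trace_pow_eq_sum {ι : Type*} [Fintype ι] [DecidableEq ι] {P : Matrix ι ι ℂ}
    (hP : P.IsHermitian) (t : ℝ) (q : ℕ) :
    ((((t : ℂ) • P - 1) ^ q).trace).re = ∑ i, (t * hP.eigenvalues i - 1) ^ q := by
  have h := hP.spectral_theorem
  set U := Unitary.conjStarAlgAut ℂ (Matrix ι ι ℂ) hP.eigenvectorUnitary with hU
  have h1 : ((t : ℂ) • P - 1) ^ q =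
      U (diagonal fun i => ((t * hP.eigenvalues i - 1 : ℝ) : ℂ) ^ q) := by
    have h2 : diagonal (fun i => ((t * hP.eigenvalues i - 1 : ℝ) : ℂ) ^ q) =
        ((t : ℂ) • diagonal (RCLike.ofReal ∘ hP.eigenvalues : ι → ℂ) - 1) ^ q := by
      have h3 : ((t : ℂ) • diagonal (RCLike.ofReal ∘ hP.eigenvalues : ι → ℂ) - 1) =
          diagonal fun i => ((t * hP.eigenvalues i - 1 : ℝ) : ℂ) := by
        ext i j
        by_cases hij : i = j
        · subst hij; simp
        · simp [hij]
      rw [h3, Matrix.diagonal_pow]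
      rfl
    rw [h2, map_pow, map_sub, map_smul, map_one, ← h]
  rw [h1, hU, Unitary.conjStarAlgAut_apply, Matrix.trace_mul_cycle]
  simp [Matrix.trace_diagonal, ← Complex.ofReal_pow, -Complex.ofReal_sub, ← Complex.ofReal_sum]

theorem even_pow_tangent {q : ℕ} (hq : Even q) (x y : ℝ) :
    x ^ q + q * x ^ (q - 1) * (y - x) ≤ y ^ q := by
  have hconv : ConvexOn ℝ Set.univ (fun x : ℝ => x ^ q) := hq.convexOn_pow
  have hd : HasDerivAt (fun x : ℝ => x ^ q) (q * x ^ (q - 1)) x := hasDerivAt_pow q x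
  rcases lt_trichotomy x y with h | h | h
  · have := hconv.le_slope_of_hasDerivAt (Set.mem_univ x) (Set.mem_univ y) h hd
    rw [slope_def_field, le_div_iff₀ (by linarith)] at this
    linarith
  · subst h; simp
  · have := hconv.slope_le_of_hasDerivAt (Set.mem_univ y) (Set.mem_univ x) h hd
    rw [slope_def_field, div_le_iff₀ (by linarith)] at this
    linarith

/-- The trace of an even power of `t P - 1` lies above its tangent lines. -/
theorem exists_slope_trace_pow {ι : Type*} [Fintype ι] [DecidableEq ι] {P : Matrix ι ι ℂ}
    (hP : P.IsHermitian) {q : ℕ} (hq : Even q) (t₀ : ℝ) :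
    ∃ s : ℝ, ∀ t : ℝ, ((((t₀ : ℂ) • P - 1) ^ q).trace).re + s * (t - t₀) ≤
      ((((t : ℂ) • P - 1) ^ q).trace).re := by
  refine ⟨∑ i, q * (t₀ * hP.eigenvalues i - 1) ^ (q - 1) * hP.eigenvalues i, fun t => ?_⟩
  rw [re_trace_pow_eq_sum hP, re_trace_pow_eq_sum hP, Finset.sum_mul, ← Finset.sum_add_distrib]
  refine Finset.sum_le_sum fun i _ => ?_
  have := even_pow_tangent hq (t₀ * hP.eigenvalues i - 1) (t * hP.eigenvalues i - 1)
  linarith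

end Convexity

/-! ### Radial Gaussian integrals -/

section Radial

open Set

theorem integral_volumeIoiPow (N : ℕ) (f : ℝ → ℝ) :
    ∫ x : Ioi (0 : ℝ), f x ∂(Measure.volumeIoiPow N) = ∫ y in Ioi (0 : ℝ), y ^ N * f y := by
  simp only [Measure.volumeIoiPow, ENNReal.ofReal]
  rw [integral_withDensity_eq_integral_smul,
    integral_subtype_comap measurableSet_Ioi fun a ↦ Real.toNNReal (a ^ N) • f a,
    setIntegral_congr_fun measurableSet_Ioi fun x hx ↦ ?_]
  · rw [NNReal.smul_def, Real.coe_toNNReal _ (pow_nonneg (le_of_lt hx) _), smul_eq_mul]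
  · exact (measurable_subtype_coe.pow_const _).real_toNNReal

theorem integrable_volumeIoiPow {N : ℕ} {f : ℝ → ℝ}
    (hf : IntegrableOn (fun y => y ^ N * f y) (Ioi 0)) :
    Integrable (fun x : Ioi (0 : ℝ) => f x) (Measure.volumeIoiPow N) := by
  rw [integrableOn_iff_comap_subtypeVal (by measurability)] at hf
  rw [Measure.volumeIoiPow, integrable_withDensity_iff_integrable_smul' (by fun_prop) (by simp)]
  refine hf.congr (Filter.Eventually.of_forall ?_)
  rintro ⟨x, hx : 0 < x⟩
  simp (disch := positivity) [ENNReal.toReal_ofReal]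

theorem integral_pow_mul_exp (k : ℕ) :
    ∫ y in Ioi (0 : ℝ), y ^ k * Real.exp (-y ^ 2) = Real.Gamma ((k + 1) / 2) / 2 := by
  have := integral_rpow_mul_exp_neg_rpow (p := 2) (q := k) (by norm_num)
    (by have : (0 : ℝ) ≤ k := by positivity
        linarith)
  simp only [Real.rpow_natCast, Real.rpow_ofNat] at this
  rw [this]
  ring

theorem integrableOn_pow_mul_exp (k : ℕ) :
    IntegrableOn (fun y : ℝ => y ^ k * Real.exp (-y ^ 2)) (Ioi 0) := by
  refine Integrable.of_integral_ne_zero ?_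
  rw [integral_pow_mul_exp]
  have : 0 < Real.Gamma (((k : ℝ) + 1) / 2) := Real.Gamma_pos_of_pos (by positivity)
  positivity

theorem integrable_radial (k j : ℕ) :
    Integrable (fun x : Ioi (0 : ℝ) => (x : ℝ) ^ j * Real.exp (-(x : ℝ) ^ 2))
      (Measure.volumeIoiPow k) := by
  refine integrable_volumeIoiPow (f := fun x => x ^ j * Real.exp (-x ^ 2)) ?_
  simp_rw [← mul_assoc, ← pow_add]
  exact integrableOn_pow_mul_exp _

theorem integral_radial (k j : ℕ) :
    ∫ x : Ioi (0 : ℝ), (x : ℝ) ^ j * Real.exp (-(x : ℝ) ^ 2) ∂(Measure.volumeIoiPow k) =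
      Real.Gamma ((((k + j : ℕ) : ℝ) + 1) / 2) / 2 := by
  rw [integral_volumeIoiPow k (fun x => x ^ j * Real.exp (-x ^ 2))]
  simp_rw [← mul_assoc, ← pow_add]
  exact integral_pow_mul_exp _

/-- The squared radius has Gaussian mean `N`, by Γ(N + 1) = N Γ(N); this will kill the linear term
of the tangent line. -/
theorem integral_radial_sq_sub {d N : ℕ} (hd : d = 2 * N) (hN : 1 ≤ N) :
    ∫ x : Ioi (0 : ℝ), ((x : ℝ) ^ 2 - N) * Real.exp (-(x : ℝ) ^ 2)
      ∂(Measure.volumeIoiPow (d - 1)) = 0 := by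
  have h0 := integrable_radial (d - 1) 0
  have h2 := integrable_radial (d - 1) 2
  simp only [pow_zero, one_mul] at h0
  simp_rw [sub_mul]
  rw [integral_sub h2 (h0.const_mul _), integral_const_mul, integral_radial]
  have h3 := integral_radial (d - 1) 0
  simp only [pow_zero, one_mul] at h3
  rw [h3]
  have e1 : (((d - 1 + 2 : ℕ) : ℝ) + 1) / 2 = N + 1 := by
    rw [show d - 1 + 2 = 2 * N + 1 by omega]; push_cast; ring
  have e2 : (((d - 1 + 0 : ℕ) : ℝ) + 1) / 2 = N := by
    obtain ⟨M, rfl⟩ : ∃ M, N = M + 1 := ⟨N - 1, by omega⟩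
    rw [show d - 1 + 0 = 2 * M + 1 by omega]; push_cast; ring
  have hN0 : (N : ℝ) ≠ 0 := by
    have : N ≠ 0 := by omega
    exact_mod_cast this
  rw [e1, e2, Real.Gamma_add_one hN0]
  ring

theorem integral_radial_pos (k : ℕ) :
    0 < ∫ x : Ioi (0 : ℝ), Real.exp (-(x : ℝ) ^ 2) ∂(Measure.volumeIoiPow k) := by
  have h3 := integral_radial k 0
  simp only [pow_zero, one_mul] at h3
  rw [h3]
  have : 0 < Real.Gamma ((((k + 0 : ℕ) : ℝ) + 1) / 2) := Real.Gamma_pos_of_pos (by positivity)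
  positivity

end Radial

/-! ### Polar coordinates -/

section Polar

open Set

variable {E : Type*} [NormedAddCommGroup E] [NormedSpace ℝ E] [FiniteDimensional ℝ E]
  [MeasurableSpace E] [BorelSpace E] [Nontrivial E] (μ : Measure E) [μ.IsAddHaarMeasure]

theorem integral_polar (F : E → ℝ) :
    ∫ x, F x ∂μ = ∫ p : Metric.sphere (0 : E) 1 × Ioi (0 : ℝ), F ((p.2 : ℝ) • (p.1 : E))
      ∂(μ.toSphere.prod (Measure.volumeIoiPow (Module.finrank ℝ E - 1))) := by
  have h := μ.measurePreserving_homeomorphUnitSphereProd.integral_comp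
    (Homeomorph.measurableEmbedding _) (fun p : Metric.sphere (0 : E) 1 × Ioi (0 : ℝ) =>
      F ((p.2 : ℝ) • (p.1 : E)))
  rw [← h]
  have h2 := integral_subtype_comap (μ := μ) (measurableSet_singleton (0 : E)).compl F
  rw [restrict_compl_singleton] at h2
  rw [← h2]
  refine integral_congr_ae (Filter.Eventually.of_forall fun x => ?_)
  have hx : ‖(x : E)‖ ≠ 0 := norm_ne_zero_iff.mpr x.2
  simp [smul_smul, hx]

theorem integrable_polar {F : E → ℝ} (hF : Integrable F μ) :
    Integrable (fun p : Metric.sphere (0 : E) 1 × Ioi (0 : ℝ) => F ((p.2 : ℝ) • (p.1 : E)))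
      (μ.toSphere.prod (Measure.volumeIoiPow (Module.finrank ℝ E - 1))) := by
  rw [← μ.measurePreserving_homeomorphUnitSphereProd.integrable_comp_emb
    (Homeomorph.measurableEmbedding _)]
  rw [← restrict_compl_singleton (μ := μ) 0, ← IntegrableOn,
    integrableOn_iff_comap_subtypeVal (by measurability)] at hF
  refine hF.congr (Filter.Eventually.of_forall fun x => ?_)
  have hx : ‖(x : E)‖ ≠ 0 := norm_ne_zero_iff.mpr x.2
  simp [smul_smul, hx]

end Polar

/-! ### From the Euclidean space to coordinates -/

section Coordinates

variable {l m n : ℕ}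

theorem partialTranspose_reducedState_eq (x : TripartiteSpace l m n) :
    partialTranspose (reducedState x) = ptGram (WithLp.ofLp x) := by
  ext i j
  simp [partialTranspose, reducedState, vecToMatrix, ptGram, Matrix.mul_apply]

theorem ptGram_smul (r : ℝ) (x : TripartiteSpace l m n) :
    ptGram (WithLp.ofLp (r • x)) = ((r ^ 2 : ℝ) : ℂ) • ptGram (WithLp.ofLp x) := by
  ext i j
  simp only [ptGram, Matrix.of_apply, Matrix.smul_apply, smul_eq_mul, Finset.mul_sum,
    PiLp.smul_apply, Complex.real_smul, map_mul, Complex.conj_ofReal]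
  refine Finset.sum_congr rfl fun z _ => ?_
  push_cast
  ring

theorem ptGram_isHermitian (v : Fin l × Fin m × Fin n → ℂ) : (ptGram v).IsHermitian := by
  ext i j
  simp [ptGram, Matrix.conjTranspose_apply, mul_comm]

theorem gaussWeight_ofLp (x : TripartiteSpace l m n) :
    gaussWeight (WithLp.ofLp x) = ((Real.exp (-‖x‖ ^ 2) : ℝ) : ℂ) := by
  rw [gaussWeight, EuclideanSpace.norm_sq_eq, ← Complex.ofReal_prod, ← Real.exp_sum,
    Finset.sum_neg_distrib]

theorem finrank_tripartiteSpace :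
    Module.finrank ℝ (TripartiteSpace l m n) = 2 * (l * (m * n)) := by
  rw [finrank_real_of_complex, finrank_euclideanSpace]
  simp

/-- The two Haar measures agree up to a constant, whose value is irrelevant because it cancels
against the total Gaussian mass. -/
theorem exists_integral_ofLp (l m n : ℕ) : ∃ C : ℝ, 0 < C ∧
    (∀ f : (Fin l × Fin m × Fin n → ℂ) → ℂ,
      ∫ x : TripartiteSpace l m n, f (WithLp.ofLp x) = C * ∫ v, f v) ∧
    (∀ f : (Fin l × Fin m × Fin n → ℂ) → ℂ, Integrable f →
      Integrable fun x : TripartiteSpace l m n => f (WithLp.ofLp x)) := by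
  let e : TripartiteSpace l m n ≃L[ℝ] (Fin l × Fin m × Fin n → ℂ) :=
    PiLp.continuousLinearEquiv 2 ℝ (fun _ => ℂ)
  let ν : Measure (Fin l × Fin m × Fin n → ℂ) :=
    (volume : Measure (TripartiteSpace l m n)).map e
  have : ν.IsAddHaarMeasure := e.isAddHaarMeasure_map volume
  obtain ⟨c, hc0, hct, hc⟩ : ∃ c : ENNReal, c ≠ 0 ∧ c ≠ ⊤ ∧ ν = c • volume := by
    refine ⟨ν.addHaarScalarFactor volume, ?_, ENNReal.coe_ne_top,
      Measure.isAddLeftInvariant_eq_smul _ _⟩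
    exact ENNReal.coe_ne_zero.mpr (Measure.addHaarScalarFactor_pos_of_isAddHaarMeasure _ _).ne'
  have hemb : MeasurableEmbedding e := e.toHomeomorph.measurableEmbedding
  refine ⟨c.toReal, ENNReal.toReal_pos hc0 hct, fun f => ?_, fun f hf => ?_⟩
  · have h1 := hemb.integral_map (μ := volume) f
    have h2 : ∫ v, f v ∂ν = c.toReal • ∫ v, f v := by rw [hc, integral_smul_measure]
    rw [← Complex.real_smul, ← h2]
    exact h1.symm
  · have h1 : Integrable f ν := by rw [hc]; exact hf.smul_measure hct
    exact (hemb.integrable_map_iff).mp h1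

end Coordinates

/-! ### Spherical moments bounded by Gaussian moments -/

section SphereMoment

open Set

variable {l m n : ℕ}

theorem traceMoment_eq (hl : 1 ≤ l) (p : ℕ) (x : TripartiteSpace l m n) :
    traceMoment p x =
      ((((((l * (m * n) : ℕ) : ℝ) / l : ℝ) : ℂ) • ptGram (WithLp.ofLp x) - 1) ^ p).trace.re := by
  have hl' : (l : ℂ) ≠ 0 := by
    have : l ≠ 0 := by omega
    exact_mod_cast this
  rw [traceMoment, centeredPT, partialTranspose_reducedState_eq]
  congr 5
  push_cast
  field_simp

theorem continuous_traceMoment (p : ℕ) :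
    Continuous fun x : TripartiteSpace l m n => traceMoment p x := by
  have h1 : Continuous fun x : TripartiteSpace l m n => centeredPT x := by
    have : ∀ x : TripartiteSpace l m n, centeredPT x =
        ((m : ℂ) * (n : ℂ)) • ptGram (WithLp.ofLp x) - 1 := by
      intro x
      rw [centeredPT, partialTranspose_reducedState_eq]
    simp_rw [this]
    suffices hp : Continuous fun x : TripartiteSpace l m n => ptGram (WithLp.ofLp x) from
      (hp.const_smul ((m : ℂ) * (n : ℂ))).sub continuous_const
    refine continuous_matrix fun i j => ?_
    simp only [ptGram, Matrix.of_apply]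
    refine continuous_finsetSum _ fun z _ => ?_
    refine Continuous.mul (by fun_prop) (Complex.continuous_conj.comp (by fun_prop))
  exact Complex.continuous_re.comp ((h1.pow p).matrix_trace)

theorem integrable_traceMoment_toSphere (p : ℕ) :
    Integrable (fun v : TripartiteSphere l m n => traceMoment p (v : TripartiteSpace l m n))
      (volume : Measure (TripartiteSpace l m n)).toSphere :=
  ((continuous_traceMoment p).comp continuous_subtype_val).integrable_of_hasCompactSupport
    (HasCompactSupport.of_compactSpace _)

theorem integrable_gaussWeight {κ : Type*} [Fintype κ] [DecidableEq κ] :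
    Integrable fun v : κ → ℂ => gaussWeight v := by
  have := integrable_monomial (κ := κ) (T := Fin 0) Fin.elim0 Fin.elim0
  simpa using this

theorem integral_gaussWeight {κ : Type*} [Fintype κ] [DecidableEq κ] :
    ∫ v : κ → ℂ, gaussWeight v = (Real.pi : ℂ) ^ Fintype.card κ := by
  have := integral_monomial (κ := κ) (T := Fin 0) Fin.elim0 Fin.elim0
  simpa using this

/-- Comparison of the moments on the sphere with the Gaussian moments. -/
theorem integral_traceMoment_toSphere_le (hl : 1 ≤ l) (hm : 1 ≤ m) (hn : 1 ≤ n) {q : ℕ}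
    (hq : Even (q + 1)) :
    ∫ v : TripartiteSphere l m n, traceMoment (q + 1) (v : TripartiteSpace l m n)
        ∂(volume : Measure (TripartiteSpace l m n)).toSphere ≤
      (volume : Measure (TripartiteSpace l m n)).toSphere.real univ *
        ∑ π ∈ derangementsFinset (q + 1), (permWeight l m n π : ℝ) / l ^ (q + 1) := by
  set σ := (volume : Measure (TripartiteSpace l m n)).toSphere
  set d := Module.finrank ℝ (TripartiteSpace l m n) with hd
  set ν := Measure.volumeIoiPow (d - 1)
  set B := ∑ π ∈ derangementsFinset (q + 1), (permWeight l m n π : ℝ) / l ^ (q + 1)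
  have hN : 1 ≤ l * (m * n) := Nat.mul_pos hl (Nat.mul_pos hm hn)
  have hdN : d = 2 * (l * (m * n)) := finrank_tripartiteSpace
  have : Nontrivial (TripartiteSpace l m n) :=
    Module.nontrivial_of_finrank_pos (R := ℝ) (by rw [← hd, hdN]; omega)
  have hl' : (0 : ℝ) < l := by exact_mod_cast hl
  obtain ⟨C, hC, hint, hintg⟩ := exists_integral_ofLp l m n
  let G : TripartiteSpace l m n → ℝ := fun x =>
    ((((l : ℂ)⁻¹ • ptGram (WithLp.ofLp x) - 1) ^ (q + 1)).trace).re * Real.exp (-‖x‖ ^ 2)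
  have hG : ∀ x : TripartiteSpace l m n, G x =
      ((((l : ℂ)⁻¹ • ptGram (WithLp.ofLp x) - 1) ^ (q + 1)).trace *
        gaussWeight (WithLp.ofLp x)).re := by
    intro x
    rw [gaussWeight_ofLp, Complex.re_mul_ofReal]
  have hGint0 := hintg _ (integrable_trace_centered_ptGram_pow (m := m) (n := n) hl q)
  have hGint : Integrable G := by
    refine hGint0.re.congr (Filter.Eventually.of_forall fun x => ?_)
    exact (hG x).symm
  have hGval : ∫ x, G x = C * (Real.pi ^ (l * (m * n)) * B) := by
    simp_rw [hG]
    have h1 := integral_re hGint0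
    simp only [RCLike.re_eq_complex_re] at h1
    rw [h1, hint fun v => (((l : ℂ)⁻¹ • ptGram v - 1) ^ (q + 1)).trace * gaussWeight v,
      integral_trace_centered_ptGram_pow hl, ← Complex.ofReal_pow,
      ← Complex.ofReal_mul, ← Complex.ofReal_mul, Complex.ofReal_re]
  have hWint0 := hintg _ (integrable_gaussWeight (κ := Fin l × Fin m × Fin n))
  have hWval : ∫ x : TripartiteSpace l m n, Real.exp (-‖x‖ ^ 2) = C * Real.pi ^ (l * (m * n)) := by
    have h1 := hint fun v => gaussWeight v
    simp_rw [gaussWeight_ofLp] at h1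
    rw [integral_complex_ofReal, integral_gaussWeight] at h1
    simp only [Fintype.card_prod, Fintype.card_fin] at h1
    exact_mod_cast h1
  have hnorm : ∀ p : TripartiteSphere l m n × Ioi (0 : ℝ),
      ‖(p.2 : ℝ) • (p.1 : TripartiteSpace l m n)‖ = p.2 := by
    intro p
    have hp : (0 : ℝ) < p.2 := p.2.2
    rw [norm_smul, norm_eq_of_mem_sphere p.1, mul_one, Real.norm_of_nonneg hp.le]
  set c₀ := ∫ r : Ioi (0 : ℝ), Real.exp (-(r : ℝ) ^ 2) ∂ν with hc₀
  have hc₀pos : 0 < c₀ := integral_radial_pos _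
  have hWpolar : ∫ x : TripartiteSpace l m n, Real.exp (-‖x‖ ^ 2) = σ.real univ * c₀ := by
    rw [integral_polar]
    simp_rw [hnorm]
    have h1 := integral_fun_snd (μ := σ) (ν := ν)
      (fun r : Ioi (0 : ℝ) => Real.exp (-(r : ℝ) ^ 2))
    exact h1
  have hGpolar := integral_polar volume G
  have hGpint := integrable_polar volume hGint
  rw [integral_prod _ hGpint] at hGpolar
  have hr0 : Integrable (fun r : Ioi (0 : ℝ) => Real.exp (-(r : ℝ) ^ 2)) ν := by
    simpa using integrable_radial (d - 1) 0
  have hr2 : Integrable (fun r : Ioi (0 : ℝ) =>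
      ((r : ℝ) ^ 2 - (l * (m * n) : ℕ)) * Real.exp (-(r : ℝ) ^ 2)) ν := by
    simp_rw [sub_mul]
    exact (integrable_radial (d - 1) 2).sub (hr0.const_mul _)
  have hrz : ∫ r : Ioi (0 : ℝ), ((r : ℝ) ^ 2 - (l * (m * n) : ℕ)) * Real.exp (-(r : ℝ) ^ 2) ∂ν
      = 0 := integral_radial_sq_sub hdN hN
  -- Jensen in the radial variable: the tangent at scale `l * (m * n) / l` is evaluated at `r ^ 2 /
  -- l` and integrated, and its linear term vanishes by `hrz`.
  have hlower : ∀ᵐ (v : TripartiteSphere l m n) ∂σ,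
      traceMoment (q + 1) (v : TripartiteSpace l m n) * c₀ ≤
      ∫ r : Ioi (0 : ℝ), G ((r : ℝ) • (v : TripartiteSpace l m n)) ∂ν := by
    filter_upwards [hGpint.prod_right_ae] with v hv
    obtain ⟨s, hs⟩ := exists_slope_trace_pow (ptGram_isHermitian (WithLp.ofLp v.1)) hq
      (((l * (m * n) : ℕ) : ℝ) / l)
    rw [← traceMoment_eq hl] at hs
    have hlow : Integrable (fun r : Ioi (0 : ℝ) =>
        traceMoment (q + 1) (v : TripartiteSpace l m n) * Real.exp (-(r : ℝ) ^ 2) +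
        s / l * (((r : ℝ) ^ 2 - (l * (m * n) : ℕ)) * Real.exp (-(r : ℝ) ^ 2))) ν :=
      (hr0.const_mul _).add (hr2.const_mul _)
    have h1 := integral_mono hlow hv (fun r => by
      have h2 := hs ((r : ℝ) ^ 2 / l)
      have h3 : G ((r : ℝ) • (v : TripartiteSpace l m n)) =
          (((((((r : ℝ) ^ 2 / l : ℝ)) : ℂ) • ptGram (WithLp.ofLp v.1) - 1) ^ (q + 1)).trace).re *
            Real.exp (-(r : ℝ) ^ 2) := by
        simp only [G]
        rw [hnorm (v, r), ptGram_smul, smul_smul]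
        congr 6
        push_cast
        rw [div_eq_inv_mul]
      simp only
      rw [h3]
      refine le_trans (le_of_eq ?_) (mul_le_mul_of_nonneg_right h2 (Real.exp_pos _).le)
      field_simp)
    rw [integral_add (hr0.const_mul _) (hr2.const_mul _), integral_const_mul, integral_const_mul,
      hrz, mul_zero, add_zero] at h1
    exact h1
  have hmain : (∫ v : TripartiteSphere l m n, traceMoment (q + 1) (v : TripartiteSpace l m n) ∂σ) *
      c₀ ≤ C * (Real.pi ^ (l * (m * n)) * B) := by
    rw [← integral_mul_const, ← hGval, hGpolar]
    exact integral_mono_ae ((integrable_traceMoment_toSphere _).mul_const _)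
      hGpint.integral_prod_left hlower
  refine le_of_mul_le_mul_right (hmain.trans (le_of_eq ?_)) hc₀pos
  rw [← mul_assoc, ← hWval, hWpolar]
  ring

theorem integral_traceMoment_uniformSphere_le (hl : 1 ≤ l) (hm : 1 ≤ m) (hn : 1 ≤ n) {q : ℕ}
    (hq : Even (q + 1)) :
    ∫ v : TripartiteSphere l m n, traceMoment (q + 1) (v : TripartiteSpace l m n)
        ∂(uniformSphere l m n) ≤
      ∑ π ∈ derangementsFinset (q + 1), (permWeight l m n π : ℝ) / l ^ (q + 1) := by
  have hN : 1 ≤ l * (m * n) := Nat.mul_pos hl (Nat.mul_pos hm hn)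
  have : Nontrivial (TripartiteSpace l m n) :=
    Module.nontrivial_of_finrank_pos (R := ℝ) (by rw [finrank_tripartiteSpace]; omega)
  have h := integral_traceMoment_toSphere_le hl hm hn hq
  have hpos : 0 < (volume : Measure (TripartiteSpace l m n)).toSphere.real univ := by
    rw [measureReal_def, ENNReal.toReal_pos_iff]
    refine ⟨?_, measure_lt_top _ _⟩
    rw [Measure.measure_univ_pos]
    exact Measure.toSphere_ne_zero _
  rw [uniformSphere, integral_smul_measure, ENNReal.toReal_inv, smul_eq_mul,
    ← measureReal_def, inv_mul_le_iff₀ hpos]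
  exact h

theorem integrable_traceMoment_uniformSphere [Nontrivial (TripartiteSpace l m n)] (p : ℕ) :
    Integrable (fun v : TripartiteSphere l m n => traceMoment p (v : TripartiteSpace l m n))
      (uniformSphere l m n) := by
  refine (integrable_traceMoment_toSphere p).smul_measure ?_
  rw [ENNReal.inv_ne_top, Ne, Measure.measure_univ_eq_zero]
  exact Measure.toSphere_ne_zero _

end SphereMoment

/-! ### Even moments, odd moments and the final estimate -/

section FinalBound

variable {l m n : ℕ}

theorem pow_four_mul_le_half {n p q : ℕ} {M : ℝ} (hM : 0 ≤ M) (hn : 1 ≤ n) (hp : 1 ≤ p)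
    (h : 2 * (p : ℝ) ^ 12 * M ≤ (n : ℝ) ^ 2) (hqp : 2 * (q : ℝ) ^ 8 ≤ (p : ℝ) ^ 12) :
    (q : ℝ) ^ 4 * (√M / n) ≤ 1 / 2 := by
  have hn' : (0 : ℝ) < n := by exact_mod_cast hn
  have hp' : (0 : ℝ) < p := by exact_mod_cast hp
  refine le_of_sq_le_sq ?_ (by norm_num)
  rw [mul_pow, div_pow, Real.sq_sqrt hM, ← pow_mul, mul_div_assoc', div_le_iff₀ (by positivity)]
  have h1 : 2 * (q : ℝ) ^ 8 * M ≤ (p : ℝ) ^ 12 * M := mul_le_mul_of_nonneg_right hqp hM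
  norm_num
  linarith

theorem integral_traceMoment_even_le (hl : 1 ≤ l) (hn : 1 ≤ n) (hmn : n ≤ m) {a : ℝ}
    (ha : a = (m : ℝ) * n / l) {p q : ℕ} (hp : 1 ≤ p)
    (h : 2 * (p : ℝ) ^ 12 * max 1 a ≤ (n : ℝ) ^ 2) (hq : Even q) (hq2 : 2 ≤ q)
    (hqp : 2 * (q : ℝ) ^ 8 ≤ (p : ℝ) ^ 12) :
    ∫ v : TripartiteSphere l m n, traceMoment q (v : TripartiteSpace l m n)
      ∂(uniformSphere l m n) ≤ 4 * (m * n) * (2 * √a) ^ q := by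
  obtain ⟨k, rfl⟩ : ∃ k, q = k + 2 := ⟨q - 2, by omega⟩
  exact (integral_traceMoment_uniformSphere_le hl (hn.trans hmn) hn (q := k + 1) hq).trans
    (sum_permWeight_le hl hn hmn ha (pow_four_mul_le_half (by positivity) hn hp h hqp))

/-- For each eigenvalue `y` of the centered matrix, the AM-GM bound y ≤ t/2 + y²/(2t) is multiplied
by the nonnegative `y ^ k`. -/
theorem traceMoment_odd_le (hl : 1 ≤ l) {k : ℕ} (hk : Even k) {t : ℝ} (ht : 0 < t)
    (x : TripartiteSpace l m n) :
    traceMoment (k + 1) x ≤ t / 2 * traceMoment k x + 1 / (2 * t) * traceMoment (k + 2) x := by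
  have hP := ptGram_isHermitian (WithLp.ofLp x)
  rw [traceMoment_eq hl, traceMoment_eq hl, traceMoment_eq hl, re_trace_pow_eq_sum hP,
    re_trace_pow_eq_sum hP, re_trace_pow_eq_sum hP, Finset.mul_sum, Finset.mul_sum,
    ← Finset.sum_add_distrib]
  refine Finset.sum_le_sum fun i _ => ?_
  set y := ((l * (m * n) : ℕ) : ℝ) / l * hP.eigenvalues i - 1
  have h1 : 0 ≤ y ^ k := hk.pow_nonneg y
  have h2 : y ≤ t / 2 + 1 / (2 * t) * y ^ 2 := by
    have : t / 2 + 1 / (2 * t) * y ^ 2 - y = (y - t) ^ 2 / (2 * t) := by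
      field_simp
      ring
    have h3 : 0 ≤ (y - t) ^ 2 / (2 * t) := by positivity
    linarith
  calc y ^ (k + 1) = y ^ k * y := pow_succ _ _
    _ ≤ y ^ k * (t / 2 + 1 / (2 * t) * y ^ 2) := mul_le_mul_of_nonneg_left h2 h1
    _ = _ := by ring

theorem traceMoment_one_eq_zero (v : TripartiteSphere l m n) :
    traceMoment 1 (v : TripartiteSpace l m n) = 0 := by
  have h1 : (ptGram (WithLp.ofLp v.1)).trace = 1 := by
    have h2 : ‖(v : TripartiteSpace l m n)‖ ^ 2 = 1 := by
      rw [norm_eq_of_mem_sphere, one_pow]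
    rw [EuclideanSpace.norm_sq_eq, Fintype.sum_prod_type] at h2
    have h3 := congrArg (fun r : ℝ => (r : ℂ)) h2
    simp only [Matrix.trace, Matrix.diag_apply, ptGram, Matrix.of_apply, Complex.mul_conj,
      Complex.normSq_eq_norm_sq]
    rw [Finset.sum_comm]
    push_cast at h3 ⊢
    exact h3
  rw [traceMoment, pow_one, centeredPT, partialTranspose_reducedState_eq, Matrix.trace_sub,
    Matrix.trace_smul, h1, Matrix.trace_one]
  simp

end FinalBound

end

theorem lemma3p3 (l m n p : ℕ) (hl : 1 ≤ l) (hp : 1 ≤ p) (hmn : n ≤ m) (a : ℝ)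
    (ha : a = (m : ℝ) * (n : ℝ) / (l : ℝ))
    (h : 2 * (p : ℝ) ^ 12 * max 1 a ≤ (n : ℝ) ^ 2) :
    Integrable (fun v : TripartiteSphere l m n => traceMoment p (v : TripartiteSpace l m n))
        (uniformSphere l m n) ∧
      ∫ v : TripartiteSphere l m n, traceMoment p (v : TripartiteSpace l m n)
          ∂(uniformSphere l m n) ≤
        2 * (m : ℝ) * (n : ℝ) * (p : ℝ) ^ 5 *
          (2 * √a + √a * (p : ℝ) / ((m : ℝ) * (n : ℝ))) ^ p := by
  have hp' : (1 : ℝ) ≤ p := by exact_mod_cast hp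
  have hn : 1 ≤ n := by
    rcases Nat.eq_zero_or_pos n with rfl | hn
    · have : 0 < 2 * (p : ℝ) ^ 12 * max 1 a := by positivity
      norm_num at h
      linarith
    · exact hn
  have hm : 1 ≤ m := hn.trans hmn
  have hN : 1 ≤ l * (m * n) := Nat.mul_pos hl (Nat.mul_pos hm hn)
  have hnt : Nontrivial (TripartiteSpace l m n) :=
    Module.nontrivial_of_finrank_pos (R := ℝ) (by rw [finrank_tripartiteSpace]; omega)
  refine ⟨integrable_traceMoment_uniformSphere p, ?_⟩
  have hl' : (0 : ℝ) < l := by exact_mod_cast hl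
  have hn' : (0 : ℝ) < n := by exact_mod_cast hn
  have hm' : (0 : ℝ) < m := by exact_mod_cast hm
  have hapos : 0 < a := by rw [ha]; positivity
  have ht : 0 < 2 * √a := by positivity
  -- The case `p = 1` is separate: its lower even neighbour has order 0, which the even bound does
  -- not cover.
  rcases Nat.lt_or_ge p 2 with hp2 | hp2
  · obtain rfl : p = 1 := by omega
    simp only [traceMoment_one_eq_zero, integral_zero]
    positivity
  have hp2' : (2 : ℝ) ≤ p := by exact_mod_cast hp2
  have hfinal : 4 * (m * n : ℝ) * (2 * √a) ^ p ≤ 2 * (m : ℝ) * (n : ℝ) * (p : ℝ) ^ 5 *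
      (2 * √a + √a * (p : ℝ) / ((m : ℝ) * (n : ℝ))) ^ p := by
    have h5 : (2 : ℝ) ≤ (p : ℝ) ^ 5 := hp2'.trans (le_self_pow₀ hp' (by norm_num))
    calc 4 * (m * n : ℝ) * (2 * √a) ^ p = 2 * m * n * 2 * (2 * √a) ^ p := by ring
      _ ≤ _ := by
        gcongr
        exact le_add_of_nonneg_right (by positivity)
  refine le_trans ?_ hfinal
  rcases Nat.even_or_odd p with he | ⟨j, hj⟩
  · refine integral_traceMoment_even_le hl hn hmn ha hp h he hp2 ?_
    have h4 : (2 : ℝ) ≤ (p : ℝ) ^ 4 := hp2'.trans (le_self_pow₀ hp' (by norm_num))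
    calc 2 * (p : ℝ) ^ 8 ≤ (p : ℝ) ^ 4 * (p : ℝ) ^ 8 := by gcongr
      _ = (p : ℝ) ^ 12 := by ring
  · have hp3 : (3 : ℝ) ≤ p := by
      have : 3 ≤ p := by omega
      exact_mod_cast this
    have h4 : (81 : ℝ) ≤ (p : ℝ) ^ 4 := by
      calc (81 : ℝ) = 3 ^ 4 := by norm_num
        _ ≤ _ := by gcongr
    -- The gap between the exponents 8 and 12 leaves room for the even order `p + 1 ≤ 4p/3`, since
    -- 2(4/3)⁸ < 81 ≤ p⁴.
    have hq : ∀ q : ℕ, q ≤ p + 1 → 2 * (q : ℝ) ^ 8 ≤ (p : ℝ) ^ 12 := by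
      intro q hq
      have hq1 : (q : ℝ) ≤ p + 1 := by exact_mod_cast hq
      have hq2 : (q : ℝ) ≤ 4 / 3 * p := by linarith
      calc 2 * (q : ℝ) ^ 8 ≤ 2 * (4 / 3 * p) ^ 8 := by gcongr
        _ = 2 * (4 / 3) ^ 8 * (p : ℝ) ^ 8 := by ring
        _ ≤ 81 * (p : ℝ) ^ 8 := by
          gcongr
          norm_num
        _ ≤ (p : ℝ) ^ 4 * (p : ℝ) ^ 8 := by gcongr
        _ = (p : ℝ) ^ 12 := by ring
    have heven : Even (2 * j) := even_two_mul j
    have hI1 := integral_traceMoment_even_le hl hn hmn ha hp h heven (by omega)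
      (hq (2 * j) (by omega))
    have hI2 := integral_traceMoment_even_le hl hn hmn ha hp h (q := 2 * j + 2)
      (heven.add even_two) (by omega) (hq (2 * j + 2) (by omega))
    -- The choice `t = 2 * √a` balances the two even bounds, so the interpolation loses no constant.
    have i1 := (integrable_traceMoment_uniformSphere (l := l) (m := m) (n := n) (2 * j)).const_mul
      ((2 * √a) / 2)
    have i2 := (integrable_traceMoment_uniformSphere (l := l) (m := m) (n := n)
      (2 * j + 2)).const_mul (1 / (2 * (2 * √a)))
    have hle := integral_mono (integrable_traceMoment_uniformSphere (2 * j + 1)) (i1.add i2)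
      (fun v => traceMoment_odd_le hl heven ht (v : TripartiteSpace l m n))
    rw [integral_add' i1 i2, integral_const_mul, integral_const_mul] at hle
    rw [hj]
    refine hle.trans ?_
    calc _ ≤ (2 * √a) / 2 * (4 * (m * n) * (2 * √a) ^ (2 * j)) +
          1 / (2 * (2 * √a)) * (4 * (m * n) * (2 * √a) ^ (2 * j + 2)) := by gcongr
      _ = 4 * (m * n) * (2 * √a) ^ (2 * j + 1) := by
        field_simp
        ring
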